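/- **Setting.** For an angle $\theta$ let $\mathbf R_\theta$ be the rotation of the plane by $\theta$ and, for $f:\mathbb R^2\to\mathbb R$, let $P_\theta f(x)=\int_{\mathbb R} f(\mathbf R_\theta^\top(x,y)^\top)\,dy$. For probability densities $f,g$ supported in the open unit disk $\mathbb D$ let $$d_{SW_2}^2(f,g)=\frac1{2\pi}\int_0^{2\pi} d_{W_2}^2(P_\theta f,P_\theta g)\,d\theta ,$$ where $d_{W_2}^2(\mu,\nu)=\inf_\gamma\int|x-y|^2\,d\gamma(x,y)$ over all couplings $\gamma$ of $\mu$ and $\nu$. **Algorithm.** Let $L,n\ge 1$, $\varepsilon\ge 0$, $h=2/L$, $t_j=-1+jh$ and $\theta_k=2\pi k/n$ ($0\le k<n$). The image $F\in\mathbb R^{L\times L}$ of $f$ consists of the averages of $f$ over the $L\times L$ square cells of side $h$ that tile $[-1,1]^2$, normalized to have sum $1$; let $f_L$ be the piecewise constant density in which cell $(a,b)$ has mass $F_{ab}$. Let $q$ run through the $L$ integers $-\lfloor L/2\rfloor,\dots,\lceil L/2\rceil-1$. A NUFFT routine of precision $\varepsilon$ returns, for every $k$, complex numbers $\widetilde y_{q,k}$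 that approximate the samples $y_{q,k}=\int f_L(\mathbf x)e^{-i\pi q\langle \mathbf R_{\theta_k}^\top(1,0)^\top,\mathbf x\rangle}d\mathbf x$ with $\big(\sum_q|\widetilde y_{q,k}-y_{q,k}|^2\big)^{1/2}\le\varepsilon\big(\sum_q|y_{q,k}|^2\big)^{1/2}$. For each $k$, the real part of $\sum_q\frac12\widetilde y_{q,k}e^{i\pi qs}$ is sampled at $s=t_0,\dots,t_{L-1}$, negative values are replaced by $0$, and the result is normalized to be a probability density that is constant on each $[t_m,t_{m+1})$. Its cumulative sums are its CDF at $t_0,\dots,t_L$; they are interpolated linearly to a function $\widetilde F_k$ on $[-1,1]$, and $U_{I,jk}=\inf\{t\in[-1,1]:\widetilde F_k(t)\ge j/L\}$ for $0\le j<L$. (If all values to be normalized vanish, any fixed convention with values in $[-1,1]$ is used.) With $V_I$ obtained from $g$ in the same way (with its own NUFFT errors), $\hat d_{SW_2}^2(F,G)=\frac1{nL}\|U_I-V_I\|_F^2$. **Theorem.** Let $K\ge0$. 1. For every $\mu_{\min}\ge 0$ there is a constant $C$, depending only on $K$ and $\mu_{\min}$, with the following property. Let $f,g$ be probability densities with support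 in the open disk $\mathbb D$ and Lipschitz on $\mathbb D$ with constant $K$, such that for all $\theta$ the projections $P_\theta f$ and $P_\theta g$ are $\ge\mu_{\min}$ wherever they do not vanish (for $\mu_{\min}=0$ this is no condition). Then for all $L,n\ge1$, $\varepsilon\ge0$ and all outputs of a NUFFT routine of precision $\varepsilon$, $$\bigl|d_{SW_2}^2(f,g)-\hat d_{SW_2}^2(F,G)\bigr|\le C\Bigl(\frac1n+\frac1L+\varepsilon\Bigr).$$ 2. There is a constant $C'$, depending only on $K$, such that for all probability densities $f,g$ with support in $\mathbb D$ and Lipschitz on $\mathbb D$ with constant $K$, all $L,n\ge1$, $\varepsilon\ge0$ and all outputs of a NUFFT routine of precision $\varepsilon$, $$\bigl|d_{SW_2}^2(f,g)-\hat d_{SW_2}^2(F,G)\bigr|\le C'\Bigl(\frac1n+\frac1{\sqrt L}+\sqrt\varepsilon\Bigr).$$ -/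

import Mathlib

open MeasureTheory
open scoped NNReal ENNReal

noncomputable section

namespace SlicedWasserstein

/-- The plane with its Euclidean norm and Lebesgue measure. -/
abbrev Plane : Type := EuclideanSpace ℝ (Fin 2)

/-! ### The continuous objects -/

/-- `f` is the density of a probability measure strictly supported in the open unit disk, and `f`
is Lipschitz on the disk with constant `K`. -/
structure IsImageDensity (K : ℝ≥0) (f : Plane → ℝ) : Prop where
  nonneg : ∀ x, 0 ≤ f x
  integral_eq_one : ∫ x, f x = 1
  support_subset : tsupport f ⊆ Metric.ball 0 1
  lipschitz : LipschitzOnWith K f (Metric.ball 0 1)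

/-- The vector `R_θᵀ (x, y)ᵀ`, where `R_θ` is the rotation by the angle `θ`. -/
def rotT (θ x y : ℝ) : Plane :=
  !₂[x * Real.cos θ + y * Real.sin θ, -x * Real.sin θ + y * Real.cos θ]

/-- The line projection (Radon transform) `P_θ f (x) = ∫ f (R_θᵀ (x, y)) dy`. -/
def radon (f : Plane → ℝ) (θ x : ℝ) : ℝ := ∫ y, f (rotT θ x y)

/-- The measure on the line with density `P_θ f`. -/
def radonMeasure (f : Plane → ℝ) (θ : ℝ) : Measure ℝ :=
  volume.withDensity fun x => ENNReal.ofReal (radon f θ x)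

/-- The couplings of two measures on the line. -/
def couplings (μ ν : Measure ℝ) : Set (Measure (ℝ × ℝ)) :=
  {γ | γ.map Prod.fst = μ ∧ γ.map Prod.snd = ν}

/-- The 2-Wasserstein distance on the line: the square root of the least quadratic transport
cost over all couplings. -/
def wasserstein2 (μ ν : Measure ℝ) : ℝ :=
  Real.sqrt (⨅ γ ∈ couplings μ ν, ∫⁻ p, ENNReal.ofReal ((p.1 - p.2) ^ 2) ∂γ).toReal

/-- The sliced 2-Wasserstein distance of two images. -/
def slicedWasserstein2 (f g : Plane → ℝ) : ℝ :=
  Real.sqrt (1 / (2 * Real.pi) *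
    ∫ θ in (0 : ℝ)..(2 * Real.pi), wasserstein2 (radonMeasure f θ) (radonMeasure g θ) ^ 2)

/-- All line projections of `f` are at least `m` wherever they do not vanish. For `m = 0` this
holds for every nonnegative `f`. -/
def HasProjectionFloor (m : ℝ) (f : Plane → ℝ) : Prop :=
  ∀ θ x, radon f θ x ≠ 0 → m ≤ radon f θ x

/-! ### Pixel images -/

/-- The side `h = 2 / L` of the cells of the `L × L` grid on `[-1, 1]²`. -/
def step (L : ℕ) : ℝ := 2 / L

/-- The grid points `-1 + j h`. -/
def node (L j : ℕ) : ℝ := -1 + j * step L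

/-- The grid cell with indices `a`, `b` (half-open, so that the cells do not overlap). -/
def cell (L a b : ℕ) : Set Plane :=
  {x | x 0 ∈ Set.Ico (node L a) (node L (a + 1)) ∧ x 1 ∈ Set.Ico (node L b) (node L (b + 1))}

/-- The average of `f` over a cell. -/
def cellAverage (L : ℕ) (f : Plane → ℝ) (a b : Fin L) : ℝ :=
  1 / step L ^ 2 * ∫ x in cell L a b, f x

/-- The `L × L` pixel image of `f`: the matrix of cell averages, normalized to have sum 1. -/
def pixelImage (L : ℕ) (f : Plane → ℝ) : Matrix (Fin L) (Fin L) ℝ :=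
  Matrix.of fun a b => cellAverage L f a b / ∑ a', ∑ b', cellAverage L f a' b'

/-- The piecewise constant density on the plane in which the cell `(a, b)` has mass `F a b`. -/
def pixelDensity (L : ℕ) (F : Matrix (Fin L) (Fin L) ℝ) (x : Plane) : ℝ :=
  ∑ a : Fin L, ∑ b : Fin L, (cell L a b).indicator (fun _ => F a b / step L ^ 2) x

/-! ### The non-uniform Fourier transform -/

/-- The `L` consecutive integers `-⌊L/2⌋, …, ⌈L/2⌉ - 1`, that is `-M, …, M - 1` if `L = 2 M`. -/
def freq (L : ℕ) (j : Fin L) : ℤ := (j : ℤ) - ((L / 2 : ℕ) : ℤ)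

/-- The `n` equispaced projection angles `2 π k / n`. -/
def angle (n : ℕ) (k : Fin n) : ℝ := 2 * Real.pi * k / n

/-- The exact samples of the central slice at angle `θ` of the Fourier transform of a pixel
image, at the angular frequencies `k π` with `k = freq L j`. As the kernel of the Fourier
transform below is `exp (-2 π i ⟨ξ, x⟩)`, the argument is `(k / 2) R_θᵀ (1, 0)ᵀ`. -/
def exactSlice (L : ℕ) (F : Matrix (Fin L) (Fin L) ℝ) (θ : ℝ) (j : Fin L) : ℂ :=
  FourierTransform.fourier (fun x : Plane => (pixelDensity L F x : ℂ))
    (((freq L j : ℝ) / 2) • rotT θ 1 0)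

/-- `Y` is a possible output, at the `n` projection angles, of a NUFFT routine with precision `ε`
applied to the pixel image `F`: at each angle the relative `ℓ²` error of the samples is at
most `ε`. -/
def IsNUFFT (ε : ℝ) (L n : ℕ) (F : Matrix (Fin L) (Fin L) ℝ) (Y : Fin n → Fin L → ℂ) : Prop :=
  ∀ k, Real.sqrt (∑ j, ‖Y k j - exactSlice L F (angle n k) j‖ ^ 2) ≤
    ε * Real.sqrt (∑ j, ‖exactSlice L F (angle n k) j‖ ^ 2)

/-! ### From Fourier samples to the computed distance -/

/-- The trigonometric polynomial on `[-1, 1]` whose Fourier samples are `y`. -/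
def trigPoly (L : ℕ) (y : Fin L → ℂ) (s : ℝ) : ℂ :=
  ∑ j, (1 / 2 : ℂ) * y j * Complex.exp (Complex.I * (freq L j : ℂ) * (Real.pi : ℂ) * (s : ℂ))

/-- The inverse discrete Fourier transform of `y`: the trigonometric polynomial, sampled at the
left ends of the `L` grid intervals of `[-1, 1]`. Imaginary and negative parts, which are pure
numerical artefacts, are discarded. -/
def rawProfile (L : ℕ) (y : Fin L → ℂ) (m : Fin L) : ℝ :=
  max 0 (trigPoly L y (node L m)).re

/-- The discrete line projection: the values of a piecewise constant density on the grid
intervals of `[-1, 1]`, normalized to total mass 1. -/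
def profile (L : ℕ) (y : Fin L → ℂ) (m : Fin L) : ℝ :=
  rawProfile L y m / (step L * ∑ m', rawProfile L y m')

/-- The matrix whose columns are the discrete line projections at the `n` angles. -/
def radonMatrix (L n : ℕ) (Y : Fin n → Fin L → ℂ) : Matrix (Fin L) (Fin n) ℝ :=
  Matrix.of fun m k => profile L (Y k) m

/-- The cumulative sums of a discrete line projection: its discrete CDF at the grid points. -/
def cumSum (L : ℕ) (u : Fin L → ℝ) (j : ℕ) : ℝ :=
  step L * ∑ m : Fin L, if (m : ℕ) < j then u m else 0

/-- The function on `[-1, 1]` that interpolates the values `c j` at the grid points linearly. -/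
def linInterp (L : ℕ) (c : ℕ → ℝ) (t : ℝ) : ℝ :=
  let j := ⌊(t + 1) / step L⌋₊
  c j + (t - node L j) / step L * (c (j + 1) - c j)

/-- The inverse, at the level `z`, of the linearly interpolated discrete CDF with node
values `c`. -/
def discreteICDF (L : ℕ) (c : ℕ → ℝ) (z : ℝ) : ℝ :=
  sInf {t | t ∈ Set.Icc (-1 : ℝ) 1 ∧ z ≤ linInterp L c t}

/-- The matrix whose columns are the discrete inverse CDFs of the columns of `U`, at the levels
`j / L` with `j = 0, …, L - 1`. -/
def icdfMatrix (L n : ℕ) (U : Matrix (Fin L) (Fin n) ℝ) : Matrix (Fin L) (Fin n) ℝ :=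
  Matrix.of fun j k => discreteICDF L (cumSum L fun m => U m k) ((j : ℝ) / L)

/-- The computed sliced 2-Wasserstein distance of two images, as a function of the NUFFT outputs
`Y` and `Z` for the two pixel images: `‖U_I - V_I‖_F / √(n L)`. -/
def computedSW2 (L n : ℕ) (Y Z : Fin n → Fin L → ℂ) : ℝ :=
  Real.sqrt (1 / ((n : ℝ) * L) * ∑ j, ∑ k,
    (icdfMatrix L n (radonMatrix L n Y) j k - icdfMatrix L n (radonMatrix L n Z) j k) ^ 2)

end SlicedWasserstein

end

/-! The error splits into a quadrature error in the angle, a quadrature error in the quantile level,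
and the error of the discrete projections at each angle.

The squared Wasserstein distance is stable under perturbation of cumulative distribution functions,
in the sup norm. A squared length $|x-y|^2$ is the area of the square with side $[x,y)$. By Fubini,
the cost of a coupling $\gamma$ is therefore an integral over $(s,t)$ of the mass that $\gamma$
carries across the interval between $s$ and $t$. The marginals bound this mass below by $(F(s\wedge
t)-G(s\vee t))^+$ from left to right and by $(G(s\wedge t)-F(s\vee t))^+$ from right to left. The
monotone coupling attains both bounds, so on $[-1,1]$ the squared distance equals `crossCost F G`,
which is visibly Lipschitz in $F$ and $G$ (`abs_crossCost_sub_le`). Quantile functions can be steep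
where a density is small, but exact and computed quantiles never have to be compared. Quantiles
enter only through the sum over the levels $j/L$, which is a Riemann sum of a bounded function whose
variation is controlled by monotone functions (`abs_riemann_sum_sub_crossCost_le`).

It remains to bound CDF errors, which are at most $L^1$ errors of densities. An image density,
extended by $0$, is Lipschitz on the whole plane. Hence its projections are Lipschitz in $x$ and in
$\theta$, and pixelation changes them by $O(h)$ uniformly. By the Fourier slice identity the samples
$y_q$ are the Fourier coefficients of the 2-periodized projection $P$ of the pixel density. This $P$
may be discontinuous, but it varies by $O(h)$ over a grid cell. That suffices: $\frac12 y$ is an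
average over $\delta\in[0,h]$ of discrete Fourier transforms of the samples $P(t_m+\delta)$, with
modulated coefficients, and each of them is $\ell^2$-close to the transform of the samples $P(t_m)$
(`l2norm_fourier_sub_le`). Discrete Parseval turns this, and the NUFFT error, into an $\ell^2$ bound
at the nodes, and Cauchy–Schwarz into the required $\ell^1$ bound.

All errors are thus linear in $1/n$, $1/L$ and $\varepsilon$. The square root rates follow from the
linear ones for $\varepsilon\le1$, and from boundedness of both distances for $\varepsilon\ge1$. -/

namespace SlicedWasserstein

/-! ### Optimal transport on `[-1, 1]` -/

/-- A continuous cumulative distribution function of a probability measure on `[-1, 1]`. -/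
structure IsUnitCDF (F : ℝ → ℝ) : Prop where
  continuous : Continuous F
  monotone : Monotone F
  eq_zero : ∀ t ≤ -1, F t = 0
  eq_one : ∀ t, 1 ≤ t → F t = 1

/-- The quantile function of a distribution on `[-1, 1]`. -/
noncomputable def quantile (F : ℝ → ℝ) (z : ℝ) : ℝ := sInf {t | t ∈ Set.Icc (-1 : ℝ) 1 ∧ z ≤ F t}

theorem IsUnitCDF.quantile_mem {F : ℝ → ℝ} (hF : IsUnitCDF F) {z : ℝ} (hz : z ≤ 1) :
    quantile F z ∈ Set.Icc (-1 : ℝ) 1 ∧ z ≤ F (quantile F z) := by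
  have hcl : IsClosed {t | t ∈ Set.Icc (-1 : ℝ) 1 ∧ z ≤ F t} :=
    isClosed_Icc.inter (isClosed_le continuous_const hF.continuous)
  exact hcl.csInf_mem ⟨1, ⟨by norm_num, le_rfl⟩, by rw [hF.eq_one 1 le_rfl]; exact hz⟩
    ⟨-1, fun t ht => ht.1.1⟩

/-- Needed for arbitrary `F`, because a computed profile that vanishes identically has no genuine
CDF. -/
theorem quantile_mem_Icc (F : ℝ → ℝ) (z : ℝ) : quantile F z ∈ Set.Icc (-1 : ℝ) 1 := by
  unfold quantile
  rcases Set.eq_empty_or_nonempty {t | t ∈ Set.Icc (-1 : ℝ) 1 ∧ z ≤ F t} with h | ⟨t, ht⟩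
  -- The infimum of the empty set is `0`, which lies in the interval.
  · rw [h]; simp
  · exact ⟨le_csInf ⟨t, ht⟩ fun s hs => hs.1.1,
      (csInf_le ⟨-1, fun s hs => hs.1.1⟩ ht).trans ht.1.2⟩

/-- The Galois connection between a CDF and its quantile function. The level `0` must be excluded:
there the right side holds for every `t`, while the quantile is `-1`. -/
theorem IsUnitCDF.quantile_le_iff {F : ℝ → ℝ} (hF : IsUnitCDF F) {z : ℝ} (hz : z ∈ Set.Ioc (0 : ℝ) 1)
    (t : ℝ) : quantile F z ≤ t ↔ z ≤ F t := by
  have hq := hF.quantile_mem hz.2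
  refine ⟨fun h => hq.2.trans (hF.monotone h), fun h => ?_⟩
  have h1 : -1 < t := by
    by_contra! h1
    linarith [hF.eq_zero t h1, hz.1]
  rcases le_total t 1 with h2 | h2
  · exact csInf_le ⟨-1, fun s hs => hs.1.1⟩ ⟨⟨h1.le, h2⟩, h⟩
  · exact hq.1.2.trans h2

theorem IsUnitCDF.monotoneOn_quantile {F : ℝ → ℝ} (hF : IsUnitCDF F) :
    MonotoneOn (quantile F) (Set.Iic 1) := by
  intro a ha b hb hab
  have hq := hF.quantile_mem hb
  exact csInf_le ⟨-1, fun s hs => hs.1.1⟩ ⟨hq.1, hab.trans hq.2⟩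

theorem IsUnitCDF.aemeasurable_quantile {F : ℝ → ℝ} (hF : IsUnitCDF F) :
    AEMeasurable (quantile F) (volume.restrict (Set.Ioc (0 : ℝ) 1)) :=
  aemeasurable_restrict_of_monotoneOn measurableSet_Ioc
    (hF.monotoneOn_quantile.mono fun _ hx => hx.2)

theorem IsUnitCDF.nonneg {F : ℝ → ℝ} (hF : IsUnitCDF F) (t : ℝ) : 0 ≤ F t := by
  rw [← hF.eq_zero (min t (-1)) (min_le_right _ _)]
  exact hF.monotone (min_le_left _ _)

theorem IsUnitCDF.le_one {F : ℝ → ℝ} (hF : IsUnitCDF F) (t : ℝ) : F t ≤ 1 := by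
  rw [← hF.eq_one (max t 1) (le_max_right _ _)]
  exact hF.monotone (le_max_left _ _)

/-! ### The transport cost as a double integral of distribution functions -/

/-- Lebesgue measure on the square `[-1, 1]²`. -/
noncomputable def squareMeasure : Measure (ℝ × ℝ) :=
  (volume.restrict (Set.Icc (-1 : ℝ) 1)).prod (volume.restrict (Set.Icc (-1 : ℝ) 1))

instance : IsFiniteMeasure squareMeasure := by
  unfold squareMeasure; infer_instance

theorem squareMeasure_univ : squareMeasure Set.univ = 4 := by
  unfold squareMeasure
  rw [← Set.univ_prod_univ, Measure.prod_prod]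
  simp only [Measure.restrict_apply_univ, Real.volume_Icc]
  rw [← ENNReal.ofReal_mul (by norm_num)]
  norm_num

/-- The quadratic transport cost between two distributions on `[-1, 1]`, in terms of their
cumulative distribution functions. -/
noncomputable def crossCost (F G : ℝ → ℝ) : ℝ≥0∞ :=
  ∫⁻ q, (ENNReal.ofReal (F (min q.1 q.2) - G (max q.1 q.2)) +
    ENNReal.ofReal (G (min q.1 q.2) - F (max q.1 q.2))) ∂squareMeasure

/-- Fubini for the relation "`p` crosses `q`": both coordinates of `q` lie between the two
coordinates of `p`. Slicing at fixed `q` gives the mass that is moved across `q`. Slicing at fixed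
`p` gives the part in the square `[-1, 1]²` of a square of side `|p.1 - p.2|`. -/
theorem lintegral_cross (γ : Measure (ℝ × ℝ)) [SFinite γ] :
    ∫⁻ q, (γ (Set.Iic (min q.1 q.2) ×ˢ Set.Ioi (max q.1 q.2)) +
      γ (Set.Ioi (max q.1 q.2) ×ˢ Set.Iic (min q.1 q.2))) ∂squareMeasure =
    ∫⁻ p, (squareMeasure (Set.Ico p.1 p.2 ×ˢ Set.Ico p.1 p.2) +
      squareMeasure (Set.Ico p.2 p.1 ×ˢ Set.Ico p.2 p.1)) ∂γ := by
  have m1 : MeasurableSet {r : (ℝ × ℝ) × (ℝ × ℝ) |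
      (r.1.1 ≤ r.2.1 ∧ r.2.1 < r.1.2) ∧ (r.1.1 ≤ r.2.2 ∧ r.2.2 < r.1.2)} := by measurability
  have m2 : MeasurableSet {r : (ℝ × ℝ) × (ℝ × ℝ) |
      (r.1.2 ≤ r.2.1 ∧ r.2.1 < r.1.1) ∧ (r.1.2 ≤ r.2.2 ∧ r.2.2 < r.1.1)} := by measurability
  have e1 : ∀ q : ℝ × ℝ, (Set.Iic (min q.1 q.2) ×ˢ Set.Ioi (max q.1 q.2)) =
      (fun p => (p, q)) ⁻¹' {r : (ℝ × ℝ) × (ℝ × ℝ) |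
      (r.1.1 ≤ r.2.1 ∧ r.2.1 < r.1.2) ∧ (r.1.1 ≤ r.2.2 ∧ r.2.2 < r.1.2)} := by
    intro q; ext p; simp; tauto
  have e2 : ∀ q : ℝ × ℝ, (Set.Ioi (max q.1 q.2) ×ˢ Set.Iic (min q.1 q.2)) =
      (fun p => (p, q)) ⁻¹' {r : (ℝ × ℝ) × (ℝ × ℝ) |
      (r.1.2 ≤ r.2.1 ∧ r.2.1 < r.1.1) ∧ (r.1.2 ≤ r.2.2 ∧ r.2.2 < r.1.1)} := by
    intro q; ext p; simp; tauto
  have e3 : ∀ p : ℝ × ℝ, (Set.Ico p.1 p.2 ×ˢ Set.Ico p.1 p.2) =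
      Prod.mk p ⁻¹' {r : (ℝ × ℝ) × (ℝ × ℝ) |
      (r.1.1 ≤ r.2.1 ∧ r.2.1 < r.1.2) ∧ (r.1.1 ≤ r.2.2 ∧ r.2.2 < r.1.2)} := by
    intro q; ext p; simp
  have e4 : ∀ p : ℝ × ℝ, (Set.Ico p.2 p.1 ×ˢ Set.Ico p.2 p.1) =
      Prod.mk p ⁻¹' {r : (ℝ × ℝ) × (ℝ × ℝ) |
      (r.1.2 ≤ r.2.1 ∧ r.2.1 < r.1.1) ∧ (r.1.2 ≤ r.2.2 ∧ r.2.2 < r.1.1)} := by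
    intro q; ext p; simp
  simp only [e1, e2, e3, e4]
  rw [lintegral_add_left (measurable_measure_prodMk_right m1),
    lintegral_add_left (measurable_measure_prodMk_left m1),
    ← Measure.prod_apply_symm m1, ← Measure.prod_apply_symm m2, Measure.prod_apply m1,
    Measure.prod_apply m2]

theorem squareMeasure_le (a b : ℝ) :
    squareMeasure (Set.Ico a b ×ˢ Set.Ico a b) ≤ ENNReal.ofReal (b - a) * ENNReal.ofReal (b - a) := by
  unfold squareMeasure
  rw [Measure.prod_prod, ← Real.volume_Ico]
  gcongr <;> exact Measure.restrict_le_self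

theorem squareMeasure_eq {a b : ℝ} (ha : -1 ≤ a) (hb : b ≤ 1) :
    squareMeasure (Set.Ico a b ×ˢ Set.Ico a b) = ENNReal.ofReal (b - a) * ENNReal.ofReal (b - a) := by
  unfold squareMeasure
  rw [Measure.prod_prod, ← Real.volume_Ico, Measure.restrict_eq_self]
  exact fun x hx => ⟨ha.trans hx.1, hx.2.le.trans hb⟩

theorem ofReal_sq_sub (a b : ℝ) :
    ENNReal.ofReal (b - a) * ENNReal.ofReal (b - a) + ENNReal.ofReal (a - b) * ENNReal.ofReal (a - b)
      = ENNReal.ofReal ((a - b) ^ 2) := by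
  rcases le_total a b with h | h
  · rw [ENNReal.ofReal_of_nonpos (sub_nonpos.2 h), ← ENNReal.ofReal_mul (sub_nonneg.2 h)]
    simp; congr 1; ring
  · rw [ENNReal.ofReal_of_nonpos (sub_nonpos.2 h), ← ENNReal.ofReal_mul (sub_nonneg.2 h)]
    simp; congr 1; ring

/-- Mass that starts left of `a` and does not end left of `b` must end to the right of `b`, hence
the lower bounds `h1` and `h2` on the crossing masses. Restriction to `[-1, 1]²` can only shrink
areas, so no support condition on `γ` is needed here. -/
theorem crossCost_le_of_coupling {F G : ℝ → ℝ} (hF : IsUnitCDF F) (hG : IsUnitCDF G)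
    {μ ν : Measure ℝ} (hμ : ∀ t, μ (Set.Iic t) = ENNReal.ofReal (F t))
    (hν : ∀ t, ν (Set.Iic t) = ENNReal.ofReal (G t)) [IsFiniteMeasure μ]
    {γ : Measure (ℝ × ℝ)} (hγ : γ ∈ couplings μ ν) :
    crossCost F G ≤ ∫⁻ p, ENNReal.ofReal ((p.1 - p.2) ^ 2) ∂γ := by
  have hfin : IsFiniteMeasure γ := by
    constructor
    have := measure_lt_top μ Set.univ
    rwa [← hγ.1, Measure.map_apply measurable_fst MeasurableSet.univ, Set.preimage_univ] at this
  have h1 : ∀ a b, ENNReal.ofReal (F a - G b) ≤ γ (Set.Iic a ×ˢ Set.Ioi b) := by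
    intro a b
    rw [ENNReal.ofReal_sub _ (hG.nonneg b), tsub_le_iff_right, ← hμ, ← hν, ← hγ.1, ← hγ.2,
      Measure.map_apply measurable_fst measurableSet_Iic,
      Measure.map_apply measurable_snd measurableSet_Iic]
    refine (measure_mono ?_).trans (measure_union_le _ _)
    intro p hp
    by_cases hb : p.2 ≤ b
    · exact Or.inr hb
    · exact Or.inl ⟨hp, not_le.1 hb⟩
  have h2 : ∀ a b, ENNReal.ofReal (G a - F b) ≤ γ (Set.Ioi b ×ˢ Set.Iic a) := by
    intro a b
    rw [ENNReal.ofReal_sub _ (hF.nonneg b), tsub_le_iff_right, ← hμ, ← hν, ← hγ.1, ← hγ.2,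
      Measure.map_apply measurable_fst measurableSet_Iic,
      Measure.map_apply measurable_snd measurableSet_Iic]
    refine (measure_mono ?_).trans (measure_union_le _ _)
    intro p hp
    by_cases hb : p.1 ≤ b
    · exact Or.inr hb
    · exact Or.inl ⟨not_le.1 hb, hp⟩
  calc crossCost F G ≤ _ := lintegral_mono fun q => add_le_add (h1 _ _) (h2 _ _)
    _ = _ := lintegral_cross γ
    _ ≤ _ := lintegral_mono fun p => by
        rw [← ofReal_sq_sub]
        exact add_le_add (squareMeasure_le _ _) (squareMeasure_le _ _)

theorem volume_Ioc_inter (a b : ℝ) (ha : 0 ≤ a) (hb : b ≤ 1) :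
    volume.restrict (Set.Ioc (0 : ℝ) 1) (Set.Ioc a b) = ENNReal.ofReal (b - a) := by
  rw [Measure.restrict_eq_self _ (Set.Ioc_subset_Ioc ha hb), Real.volume_Ioc]

/-- The monotone coupling of two distributions on `[-1, 1]`. -/
noncomputable def quantileCoupling (F G : ℝ → ℝ) : Measure (ℝ × ℝ) :=
  (volume.restrict (Set.Ioc (0 : ℝ) 1)).map fun z => (quantile F z, quantile G z)

theorem quantileCoupling_apply {F G : ℝ → ℝ} (hF : IsUnitCDF F) (hG : IsUnitCDF G)
    {s : Set (ℝ × ℝ)} (hs : MeasurableSet s) (t : Set ℝ)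
    (h : ∀ z ∈ Set.Ioc (0 : ℝ) 1, (quantile F z, quantile G z) ∈ s ↔ z ∈ t) :
    quantileCoupling F G s = volume.restrict (Set.Ioc (0 : ℝ) 1) t := by
  unfold quantileCoupling
  rw [Measure.map_apply_of_aemeasurable
    (hF.aemeasurable_quantile.prodMk hG.aemeasurable_quantile) hs]
  refine measure_congr ?_
  filter_upwards [ae_restrict_mem measurableSet_Ioc] with z hz
  exact propext (h z hz)

/-- For the monotone coupling the lower bounds on the crossing masses are equalities: by the Galois
connection the levels `z` that cross from left of `a` to right of `b` form the interval `(G b, F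
a]`. The coupling lives on `[-1, 1]²`, so no area is lost either. -/
theorem lintegral_quantileCoupling {F G : ℝ → ℝ} (hF : IsUnitCDF F) (hG : IsUnitCDF G) :
    ∫⁻ p, ENNReal.ofReal ((p.1 - p.2) ^ 2) ∂(quantileCoupling F G) = crossCost F G := by
  have : SFinite (quantileCoupling F G) := by unfold quantileCoupling; infer_instance
  have h3 : ∀ᵐ p ∂(quantileCoupling F G), p ∈ Set.Icc (-1 : ℝ) 1 ×ˢ Set.Icc (-1 : ℝ) 1 := by
    unfold quantileCoupling
    refine (ae_map_iff (p := fun p => p ∈ Set.Icc (-1 : ℝ) 1 ×ˢ Set.Icc (-1 : ℝ) 1)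
      (hF.aemeasurable_quantile.prodMk hG.aemeasurable_quantile)
      (measurableSet_Icc.prod measurableSet_Icc)).2 ?_
    exact Filter.Eventually.of_forall fun z => ⟨quantile_mem_Icc _ _, quantile_mem_Icc _ _⟩
  have h1 : ∀ a b, quantileCoupling F G (Set.Iic a ×ˢ Set.Ioi b) = ENNReal.ofReal (F a - G b) := by
    intro a b
    rw [quantileCoupling_apply hF hG (measurableSet_Iic.prod measurableSet_Ioi)
      (Set.Ioc (G b) (F a)), volume_Ioc_inter _ _ (hG.nonneg _) (hF.le_one _)]
    intro z hz
    simp only [Set.mem_prod, Set.mem_Iic, Set.mem_Ioi, Set.mem_Ioc, hF.quantile_le_iff hz,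
      ← not_le, hG.quantile_le_iff hz]
    tauto
  have h2 : ∀ a b, quantileCoupling F G (Set.Ioi b ×ˢ Set.Iic a) = ENNReal.ofReal (G a - F b) := by
    intro a b
    rw [quantileCoupling_apply hF hG (measurableSet_Ioi.prod measurableSet_Iic)
      (Set.Ioc (F b) (G a)), volume_Ioc_inter _ _ (hF.nonneg _) (hG.le_one _)]
    intro z hz
    simp only [Set.mem_prod, Set.mem_Iic, Set.mem_Ioi, Set.mem_Ioc, hG.quantile_le_iff hz,
      ← not_le, hF.quantile_le_iff hz]
  unfold crossCost
  simp only [← h1, ← h2]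
  rw [lintegral_cross]
  refine lintegral_congr_ae ?_
  filter_upwards [h3] with p hp
  rw [squareMeasure_eq hp.1.1 hp.2.2, squareMeasure_eq hp.2.1 hp.1.2, ofReal_sq_sub]

theorem quantileCoupling_mem {F G : ℝ → ℝ} (hF : IsUnitCDF F) (hG : IsUnitCDF G)
    {μ ν : Measure ℝ} [IsFiniteMeasure μ] [IsFiniteMeasure ν]
    (hμ : ∀ t, μ (Set.Iic t) = ENNReal.ofReal (F t))
    (hν : ∀ t, ν (Set.Iic t) = ENNReal.ofReal (G t)) : quantileCoupling F G ∈ couplings μ ν := by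
  have : IsFiniteMeasure (quantileCoupling F G) := by unfold quantileCoupling; infer_instance
  constructor
  · refine Measure.ext_of_Iic _ _ fun t => ?_
    rw [Measure.map_apply measurable_fst measurableSet_Iic,
      quantileCoupling_apply hF hG (measurable_fst measurableSet_Iic) (Set.Ioc 0 (F t)),
      volume_Ioc_inter _ _ le_rfl (hF.le_one _), sub_zero, hμ]
    intro z hz
    simp [hF.quantile_le_iff hz, hz.1]
  · refine Measure.ext_of_Iic _ _ fun t => ?_
    rw [Measure.map_apply measurable_snd measurableSet_Iic,
      quantileCoupling_apply hF hG (measurable_snd measurableSet_Iic) (Set.Ioc 0 (G t)),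
      volume_Ioc_inter _ _ le_rfl (hG.le_one _), sub_zero, hν]
    intro z hz
    simp [hG.quantile_le_iff hz, hz.1]

theorem wasserstein2_sq {F G : ℝ → ℝ} (hF : IsUnitCDF F) (hG : IsUnitCDF G)
    {μ ν : Measure ℝ} [IsFiniteMeasure μ] [IsFiniteMeasure ν]
    (hμ : ∀ t, μ (Set.Iic t) = ENNReal.ofReal (F t))
    (hν : ∀ t, ν (Set.Iic t) = ENNReal.ofReal (G t)) :
    wasserstein2 μ ν ^ 2 = (crossCost F G).toReal := by
  unfold wasserstein2
  rw [Real.sq_sqrt ENNReal.toReal_nonneg]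
  congr 1
  refine le_antisymm ?_ (le_iInf₂ fun γ hγ => crossCost_le_of_coupling hF hG hμ hν hγ)
  rw [← lintegral_quantileCoupling hF hG]
  exact iInf₂_le _ (quantileCoupling_mem hF hG hμ hν)

/-- Each of the two positive parts in the integrand changes by at most `a + b`, and the square has
area `4`. -/
theorem crossCost_le_add {F G F' G' : ℝ → ℝ} {a b : ℝ}
    (ha : ∀ t ∈ Set.Icc (-1 : ℝ) 1, |F t - F' t| ≤ a)
    (hb : ∀ t ∈ Set.Icc (-1 : ℝ) 1, |G t - G' t| ≤ b) :
    crossCost F G ≤ crossCost F' G' + ENNReal.ofReal (8 * (a + b)) := by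
  have ha0 : 0 ≤ a := (abs_nonneg _).trans (ha 0 (by norm_num))
  have hb0 : 0 ≤ b := (abs_nonneg _).trans (hb 0 (by norm_num))
  have hc : ∫⁻ _, ENNReal.ofReal (2 * (a + b)) ∂squareMeasure = ENNReal.ofReal (8 * (a + b)) := by
    rw [lintegral_const, squareMeasure_univ, show (4 : ℝ≥0∞) = ENNReal.ofReal 4 by norm_num,
      ← ENNReal.ofReal_mul (by positivity)]
    congr 1; ring
  unfold crossCost
  rw [← hc, ← lintegral_add_right _ measurable_const]
  refine lintegral_mono_ae ?_
  have hmem : ∀ᵐ q ∂squareMeasure, q ∈ Set.Icc (-1 : ℝ) 1 ×ˢ Set.Icc (-1 : ℝ) 1 := by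
    unfold squareMeasure
    rw [Measure.prod_restrict]
    exact ae_restrict_mem (measurableSet_Icc.prod measurableSet_Icc)
  filter_upwards [hmem] with q hq
  have hmin : min q.1 q.2 ∈ Set.Icc (-1 : ℝ) 1 :=
    ⟨le_min hq.1.1 hq.2.1, (min_le_left _ _).trans hq.1.2⟩
  have hmax : max q.1 q.2 ∈ Set.Icc (-1 : ℝ) 1 :=
    ⟨hq.1.1.trans (le_max_left _ _), max_le hq.1.2 hq.2.2⟩
  have key : ∀ x y : ℝ, x ≤ y + (a + b) →
      ENNReal.ofReal x ≤ ENNReal.ofReal y + ENNReal.ofReal (a + b) := fun x y h =>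
    (ENNReal.ofReal_le_ofReal h).trans ENNReal.ofReal_add_le
  have e1 := abs_le.1 (ha _ hmin)
  have e2 := abs_le.1 (ha _ hmax)
  have e3 := abs_le.1 (hb _ hmin)
  have e4 := abs_le.1 (hb _ hmax)
  rw [two_mul (a + b), ENNReal.ofReal_add (by positivity) (by positivity), add_add_add_comm]
  exact add_le_add (key _ _ (by linarith)) (key _ _ (by linarith))

theorem crossCost_zero : crossCost 0 0 = 0 := by simp [crossCost]

theorem crossCost_ne_top {F G : ℝ → ℝ} (hF : IsUnitCDF F) (hG : IsUnitCDF G) :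
    crossCost F G ≠ ∞ := by
  -- Comparison with zero functions, from which values in `[0, 1]` differ by at most `1`.
  have := crossCost_le_add (F := F) (G := G) (F' := 0) (G' := 0) (a := 1) (b := 1)
    (fun t _ => by simpa [abs_of_nonneg (hF.nonneg t)] using hF.le_one t)
    (fun t _ => by simpa [abs_of_nonneg (hG.nonneg t)] using hG.le_one t)
  rw [crossCost_zero, zero_add] at this
  exact ne_top_of_le_ne_top ENNReal.ofReal_ne_top this

theorem abs_crossCost_sub_le {F G F' G' : ℝ → ℝ} (hF : IsUnitCDF F) (hG : IsUnitCDF G)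
    (hF' : IsUnitCDF F') (hG' : IsUnitCDF G') {a b : ℝ}
    (ha : ∀ t ∈ Set.Icc (-1 : ℝ) 1, |F t - F' t| ≤ a)
    (hb : ∀ t ∈ Set.Icc (-1 : ℝ) 1, |G t - G' t| ≤ b) :
    |(crossCost F G).toReal - (crossCost F' G').toReal| ≤ 8 * (a + b) := by
  have ha0 : 0 ≤ a := (abs_nonneg _).trans (ha 0 (by norm_num))
  have hb0 : 0 ≤ b := (abs_nonneg _).trans (hb 0 (by norm_num))
  have key : ∀ {x y : ℝ≥0∞}, y ≠ ∞ → x ≤ y + ENNReal.ofReal (8 * (a + b)) →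
      x.toReal ≤ y.toReal + 8 * (a + b) := by
    intro x y hy h
    have := ENNReal.toReal_mono (ENNReal.add_ne_top.2 ⟨hy, ENNReal.ofReal_ne_top⟩) h
    rwa [ENNReal.toReal_add hy ENNReal.ofReal_ne_top,
      ENNReal.toReal_ofReal (by positivity)] at this
  have h1 := key (crossCost_ne_top hF' hG') (crossCost_le_add ha hb)
  have h2 := key (crossCost_ne_top hF hG) (crossCost_le_add (F := F') (G := G') (F' := F) (G' := G)
    (fun t ht => by rw [abs_sub_comm]; exact ha t ht)
    (fun t ht => by rw [abs_sub_comm]; exact hb t ht))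
  rw [abs_le]; constructor <;> linarith

/-! ### The cost through quantile functions, and its Riemann sums -/

theorem sq_quantile_sub_le (F G : ℝ → ℝ) (z : ℝ) : (quantile F z - quantile G z) ^ 2 ≤ 4 := by
  obtain ⟨h1, h2⟩ := quantile_mem_Icc F z
  obtain ⟨h3, h4⟩ := quantile_mem_Icc G z
  nlinarith

theorem integrable_sq_quantile_sub {F G : ℝ → ℝ} (hF : IsUnitCDF F) (hG : IsUnitCDF G) :
    Integrable (fun z => (quantile F z - quantile G z) ^ 2)
      (volume.restrict (Set.Ioc (0 : ℝ) 1)) := by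
  refine Integrable.of_bound
    ((hF.aemeasurable_quantile.sub hG.aemeasurable_quantile).pow_const 2).aestronglyMeasurable 4 ?_
  refine Filter.Eventually.of_forall fun z => ?_
  rw [Real.norm_of_nonneg (sq_nonneg _)]
  exact sq_quantile_sub_le F G z

theorem crossCost_toReal_eq {F G : ℝ → ℝ} (hF : IsUnitCDF F) (hG : IsUnitCDF G) :
    (crossCost F G).toReal = ∫ z in (0 : ℝ)..1, (quantile F z - quantile G z) ^ 2 := by
  rw [intervalIntegral.integral_of_le zero_le_one, integral_eq_lintegral_of_nonneg_ae
    (Filter.Eventually.of_forall fun z => sq_nonneg _)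
    (integrable_sq_quantile_sub hF hG).aestronglyMeasurable, ← lintegral_quantileCoupling hF hG]
  unfold quantileCoupling
  rw [lintegral_map' (by fun_prop) (hF.aemeasurable_quantile.prodMk hG.aemeasurable_quantile)]

theorem crossCost_toReal_le {F G : ℝ → ℝ} (hF : IsUnitCDF F) (hG : IsUnitCDF G) :
    (crossCost F G).toReal ≤ 4 := by
  rw [crossCost_toReal_eq hF hG]
  have := intervalIntegral.norm_integral_le_of_norm_le_const (a := (0 : ℝ)) (b := 1) (C := 4)
    (f := fun z => (quantile F z - quantile G z) ^ 2) (fun z _ => by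
      rw [Real.norm_of_nonneg (sq_nonneg _)]; exact sq_quantile_sub_le F G z)
  simpa using (le_abs_self _).trans this

/-- Quantile functions may jump, but they are monotone with values in `[-1, 1]`. The oscillation of
the squared difference over one level interval is at most `4` times the increment of the sum of the
two quantiles. These increments telescope to at most `4`, hence `16 / L`. -/
theorem abs_riemann_sum_sub_crossCost_le {F G : ℝ → ℝ} (hF : IsUnitCDF F) (hG : IsUnitCDF G)
    {L : ℕ} (hL : 0 < L) :
    |1 / (L : ℝ) * ∑ j : Fin L, (quantile F ((j : ℝ) / L) - quantile G ((j : ℝ) / L)) ^ 2 -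
      (crossCost F G).toReal| ≤ 16 / L := by
  have hL' : (0 : ℝ) < L := by exact_mod_cast hL
  rw [Fin.sum_univ_eq_sum_range (fun j : ℕ =>
    (quantile F ((j : ℝ) / L) - quantile G ((j : ℝ) / L)) ^ 2) L, crossCost_toReal_eq hF hG]
  set φ : ℝ → ℝ := fun z => (quantile F z - quantile G z) ^ 2 with hφ
  have hint : IntervalIntegrable φ volume 0 1 := by
    rw [intervalIntegrable_iff_integrableOn_Ioc_of_le zero_le_one]
    exact integrable_sq_quantile_sub hF hG
  have hle : ∀ j : ℕ, ((j : ℝ) / L) ≤ ((j + 1 : ℕ) : ℝ) / L := fun j => by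
    gcongr; simp
  have hsub : ∀ j ∈ Finset.range L, ∀ z ∈ Set.Icc ((j : ℝ) / L) (((j + 1 : ℕ) : ℝ) / L),
      0 ≤ z ∧ z ≤ 1 := by
    intro j hj z hz
    refine ⟨le_trans (by positivity) hz.1, hz.2.trans ?_⟩
    rw [div_le_one hL']
    exact_mod_cast Finset.mem_range.1 hj
  have hint' : ∀ j < L, IntervalIntegrable φ volume ((j : ℝ) / L) (((j + 1 : ℕ) : ℝ) / L) := by
    intro j hj
    refine hint.mono_set ?_
    rw [Set.uIcc_of_le (hle j), Set.uIcc_of_le zero_le_one]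
    exact fun z hz => hsub j (Finset.mem_range.2 hj) z hz
  have hsum := intervalIntegral.sum_integral_adjacent_intervals
    (a := fun j : ℕ => (j : ℝ) / L) hint'
  simp only [Nat.cast_zero, zero_div, div_self hL'.ne'] at hsum
  rw [← hsum, Finset.mul_sum, ← Finset.sum_sub_distrib]
  set B : ℕ → ℝ := fun j => 4 * (quantile F ((j : ℝ) / L) + quantile G ((j : ℝ) / L)) with hB
  have hterm : ∀ j ∈ Finset.range L,
      |1 / (L : ℝ) * φ ((j : ℝ) / L) - ∫ z in ((j : ℝ) / L)..(((j + 1 : ℕ) : ℝ) / L), φ z| ≤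
        (B (j + 1) - B j) * (1 / L) := by
    intro j hj
    have hlen : ((j + 1 : ℕ) : ℝ) / L - (j : ℝ) / L = 1 / L := by
      rw [← sub_div]; push_cast; congr 1; ring
    have e : 1 / (L : ℝ) * φ ((j : ℝ) / L) =
        ∫ _z in ((j : ℝ) / L)..(((j + 1 : ℕ) : ℝ) / L), φ ((j : ℝ) / L) := by
      rw [intervalIntegral.integral_const, hlen, smul_eq_mul]
    rw [e, ← intervalIntegral.integral_sub intervalIntegrable_const
      (hint' j (Finset.mem_range.1 hj)), ← Real.norm_eq_abs]
    refine (intervalIntegral.norm_integral_le_of_norm_le_const (C := B (j + 1) - B j) ?_).trans ?_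
    · intro z hz
      rw [Set.uIoc_of_le (hle j)] at hz
      have hz' : z ∈ Set.Icc ((j : ℝ) / L) (((j + 1 : ℕ) : ℝ) / L) := ⟨hz.1.le, hz.2⟩
      have i0 := (hsub j hj _ ⟨le_rfl, hle j⟩).2
      have i1 := (hsub j hj z hz').2
      have i2 := (hsub j hj _ ⟨hle j, le_rfl⟩).2
      have f1 := hF.monotoneOn_quantile i0 i1 hz'.1
      have f2 := hF.monotoneOn_quantile i1 i2 hz'.2
      have g1 := hG.monotoneOn_quantile i0 i1 hz'.1
      have g2 := hG.monotoneOn_quantile i1 i2 hz'.2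
      obtain ⟨a1, a2⟩ := quantile_mem_Icc F z
      obtain ⟨a3, a4⟩ := quantile_mem_Icc G z
      obtain ⟨b1, b2⟩ := quantile_mem_Icc F ((j : ℝ) / L)
      obtain ⟨b3, b4⟩ := quantile_mem_Icc G ((j : ℝ) / L)
      simp only [hφ, hB, Real.norm_eq_abs]
      have d1 : |(quantile F ((j : ℝ) / L) - quantile G ((j : ℝ) / L)) -
          (quantile F z - quantile G z)| ≤
          (quantile F (((j + 1 : ℕ) : ℝ) / L) + quantile G (((j + 1 : ℕ) : ℝ) / L)) -
          (quantile F ((j : ℝ) / L) + quantile G ((j : ℝ) / L)) := by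
        rw [abs_le]; constructor <;> linarith
      have d2 : |(quantile F ((j : ℝ) / L) - quantile G ((j : ℝ) / L)) +
          (quantile F z - quantile G z)| ≤ 4 := by
        rw [abs_le]; constructor <;> linarith
      rw [sq_sub_sq, abs_mul]
      calc _ ≤ 4 * _ := mul_le_mul d2 d1 (abs_nonneg _) (by norm_num)
        _ = _ := by ring
    · rw [hlen, abs_of_pos (by positivity)]
  refine (Finset.abs_sum_le_sum_abs _ _).trans ((Finset.sum_le_sum hterm).trans ?_)
  rw [← Finset.sum_mul, Finset.sum_range_sub]
  obtain ⟨b1, b2⟩ := quantile_mem_Icc F ((L : ℝ) / L)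
  obtain ⟨b3, b4⟩ := quantile_mem_Icc G ((L : ℝ) / L)
  obtain ⟨b5, b6⟩ := quantile_mem_Icc F (((0 : ℕ) : ℝ) / L)
  obtain ⟨b7, b8⟩ := quantile_mem_Icc G (((0 : ℕ) : ℝ) / L)
  rw [mul_one_div]
  gcongr
  simp only [hB]
  linarith

/-! ### Piecewise constant densities on the grid -/

theorem step_pos {L : ℕ} (hL : 0 < L) : 0 < step L := by
  unfold step; positivity

theorem mul_step {L : ℕ} (hL : 0 < L) : (L : ℝ) * step L = 2 := by
  unfold step; field_simp

theorem node_succ (L j : ℕ) : node L (j + 1) = node L j + step L := by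
  unfold node; push_cast; ring

theorem node_zero (L : ℕ) : node L 0 = -1 := by simp [node]

theorem node_last {L : ℕ} (hL : 0 < L) : node L L = 1 := by
  unfold node; rw [mul_step hL]; norm_num

theorem node_mono {L : ℕ} (hL : 0 < L) : Monotone (node L) := by
  intro a b hab
  unfold node
  have := (step_pos hL).le
  gcongr

theorem node_mem_Icc {L : ℕ} (hL : 0 < L) {j : ℕ} (hj : j ≤ L) :
    node L j ∈ Set.Icc (-1 : ℝ) 1 :=
  ⟨by simpa [node_zero] using node_mono hL (Nat.zero_le j),
    by simpa [node_last hL] using node_mono hL hj⟩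

/-- The cumulative distribution function of a piecewise constant density on the grid. -/
noncomputable def stepCDF (L : ℕ) (u : Fin L → ℝ) (t : ℝ) : ℝ :=
  ∑ m : Fin L, u m * (min t (node L (m + 1)) - min t (node L m))

theorem floor_node_le {L : ℕ} (hL : 0 < L) {t : ℝ} (ht : -1 ≤ t) :
    node L ⌊(t + 1) / step L⌋₊ ≤ t ∧ t < node L (⌊(t + 1) / step L⌋₊ + 1) := by
  have hs := step_pos hL
  have h1 := Nat.floor_le (div_nonneg (by linarith : 0 ≤ t + 1) hs.le)
  have h2 := Nat.lt_floor_add_one ((t + 1) / step L)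
  rw [le_div_iff₀ hs] at h1
  rw [div_lt_iff₀ hs] at h2
  unfold node
  push_cast
  constructor <;> linarith

/-- The cell `m` contributes fully, partially or not at all according to its position relative to
the cell `j` that contains `t`. Points `t ≥ 1` are covered too, as then every `m` is smaller than
`j`. -/
theorem linInterp_cumSum {L : ℕ} (hL : 0 < L) (u : Fin L → ℝ) {t : ℝ} (ht : -1 ≤ t) :
    linInterp L (cumSum L u) t = stepCDF L u t := by
  obtain ⟨h1, h2⟩ := floor_node_le hL ht
  have hs := step_pos hL
  unfold linInterp stepCDF cumSum
  simp only
  set j := ⌊(t + 1) / step L⌋₊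
  rw [← mul_sub, ← Finset.sum_sub_distrib, ← mul_assoc, div_mul_cancel₀ _ hs.ne', Finset.mul_sum,
    Finset.mul_sum, ← Finset.sum_add_distrib]
  refine Finset.sum_congr rfl fun m _ => ?_
  rcases lt_trichotomy (m : ℕ) j with h | h | h
  · have a1 : node L (m + 1) ≤ t := (node_mono hL h).trans h1
    have a2 : node L m ≤ t := (node_mono hL h.le).trans h1
    rw [if_pos h, if_pos (by omega), min_eq_right a1, min_eq_right a2, node_succ]
    ring
  · rw [if_neg (by omega), if_pos (by omega), h, min_eq_right h1, min_eq_left h2.le]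
    ring
  · have a1 : t ≤ node L m := h2.le.trans (node_mono hL h)
    have a2 : t ≤ node L (m + 1) := a1.trans (node_mono hL (Nat.le_succ _))
    rw [if_neg (by omega), if_neg (by omega), min_eq_left a1, min_eq_left a2]
    ring

theorem discreteICDF_eq_quantile {L : ℕ} (hL : 0 < L) (u : Fin L → ℝ) (z : ℝ) :
    discreteICDF L (cumSum L u) z = quantile (stepCDF L u) z := by
  unfold discreteICDF quantile
  congr 1
  ext t
  refine and_congr_right fun ht => ?_
  rw [linInterp_cumSum hL u ht.1]

theorem isUnitCDF_stepCDF {L : ℕ} (hL : 0 < L) {u : Fin L → ℝ} (h0 : ∀ m, 0 ≤ u m)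
    (h1 : step L * ∑ m, u m = 1) : IsUnitCDF (stepCDF L u) where
  continuous := by unfold stepCDF; fun_prop
  monotone := by
    intro s t hst
    unfold stepCDF
    refine Finset.sum_le_sum fun m _ => mul_le_mul_of_nonneg_left ?_ (h0 m)
    have hn : node L m ≤ node L (m + 1) := node_mono hL (Nat.le_succ _)
    rcases le_total t (node L m) with h | h
    · rw [min_eq_left h, min_eq_left (h.trans hn), min_eq_left (hst.trans h),
        min_eq_left ((hst.trans h).trans hn)]
      linarith
    · rw [min_eq_right h]
      rcases le_total s (node L m) with h' | h'
      · rw [min_eq_left h', min_eq_left (h'.trans hn)]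
        have := le_min h hn
        linarith
      · rw [min_eq_right h']
        have := min_le_min_right (node L (m + 1)) hst
        linarith
  eq_zero := by
    intro t ht
    refine Finset.sum_eq_zero fun m _ => ?_
    rw [min_eq_left (ht.trans (node_mem_Icc hL m.2).1),
      min_eq_left (ht.trans (node_mem_Icc hL m.2.le).1)]
    ring
  eq_one := by
    intro t ht
    rw [← h1, Finset.mul_sum]
    refine Finset.sum_congr rfl fun m _ => ?_
    rw [min_eq_right ((node_mem_Icc hL m.2).2.trans ht),
      min_eq_right ((node_mem_Icc hL m.2.le).2.trans ht), node_succ]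
    ring

/-! ### Lipschitz densities on the line and their discretizations -/

section LipDensity

/-- `p` is a Lipschitz probability density that vanishes outside of `(-1, 1)`. -/
structure IsLipDensity (A : ℝ) (p : ℝ → ℝ) : Prop where
  nonneg : ∀ x, 0 ≤ p x
  lip : ∀ x y, |p x - p y| ≤ A * |x - y|
  eq_zero : ∀ x, 1 ≤ |x| → p x = 0
  integral : ∫ x in (-1 : ℝ)..1, p x = 1

/-- The cumulative distribution function of a density that vanishes outside of `(-1, 1)`. -/
noncomputable def densityCDF (p : ℝ → ℝ) (t : ℝ) : ℝ := ∫ x in (-1 : ℝ)..t, p x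

variable {A : ℝ} {p : ℝ → ℝ}

theorem IsLipDensity.const_nonneg (hp : IsLipDensity A p) : 0 ≤ A := by
  simpa using (abs_nonneg _).trans (hp.lip 1 0)

theorem IsLipDensity.continuous (hp : IsLipDensity A p) : Continuous p := by
  refine (LipschitzWith.of_dist_le_mul (K := ⟨A, hp.const_nonneg⟩) fun x y => ?_).continuous
  exact hp.lip x y

theorem IsLipDensity.intervalIntegrable (hp : IsLipDensity A p) (a b : ℝ) :
    IntervalIntegrable p volume a b := hp.continuous.intervalIntegrable _ _

theorem IsLipDensity.densityCDF_sub (hp : IsLipDensity A p) (s t : ℝ) :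
    densityCDF p t - densityCDF p s = ∫ x in s..t, p x :=
  intervalIntegral.integral_interval_sub_left (hp.intervalIntegrable _ _)
    (hp.intervalIntegrable _ _)

theorem IsLipDensity.isUnitCDF (hp : IsLipDensity A p) : IsUnitCDF (densityCDF p) where
  continuous := intervalIntegral.continuous_primitive hp.intervalIntegrable _
  monotone := by
    intro s t hst
    rw [← sub_nonneg, hp.densityCDF_sub]
    exact intervalIntegral.integral_nonneg hst fun x _ => hp.nonneg x
  eq_zero := by
    intro t ht
    unfold densityCDF
    refine intervalIntegral.integral_zero_ae (Filter.Eventually.of_forall fun x hx => ?_)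
    rw [Set.uIoc_of_ge ht] at hx
    exact hp.eq_zero x (by rw [abs_of_nonpos (by linarith [hx.2])]; linarith [hx.2])
  eq_one := by
    intro t ht
    rw [← hp.integral, ← sub_eq_zero]
    refine (hp.densityCDF_sub 1 t).trans ?_
    refine intervalIntegral.integral_zero_ae (Filter.Eventually.of_forall fun x hx => ?_)
    rw [Set.uIoc_of_le ht] at hx
    exact hp.eq_zero x (hx.1.le.trans (le_abs_self x))

theorem IsLipDensity.abs_mul_sub_integral_le (hp : IsLipDensity A p) {a s t h : ℝ} (has : a ≤ s)
    (hst : s ≤ t) (hta : t ≤ a + h) :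
    |p a * (t - s) - ∫ x in s..t, p x| ≤ A * h * (t - s) := by
  have e : p a * (t - s) = ∫ _x in s..t, p a := by
    rw [intervalIntegral.integral_const, smul_eq_mul, mul_comm]
  rw [e, ← intervalIntegral.integral_sub intervalIntegrable_const (hp.intervalIntegrable _ _),
    ← Real.norm_eq_abs]
  refine (intervalIntegral.norm_integral_le_of_norm_le_const (C := A * h) fun x hx => ?_).trans ?_
  · rw [Set.uIoc_of_le hst] at hx
    refine (hp.lip a x).trans (mul_le_mul_of_nonneg_left ?_ hp.const_nonneg)
    rw [abs_le]; constructor <;> linarith [hx.1, hx.2]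
  · rw [abs_of_nonneg (sub_nonneg.2 hst)]

/-- A CDF error is at most an `L¹` error. In each cell, `p` differs from its value at the left node
by at most `A * step L`, and the cells have total length `2`. -/
theorem IsLipDensity.abs_stepCDF_sub_le (hp : IsLipDensity A p) {L : ℕ} (hL : 0 < L)
    (u : Fin L → ℝ) {t : ℝ} (ht : t ∈ Set.Icc (-1 : ℝ) 1) :
    |stepCDF L u t - densityCDF p t| ≤
      step L * ∑ m : Fin L, |u m - p (node L m)| + 2 * A * step L := by
  have hs := (step_pos hL).le
  have e : densityCDF p t = ∑ m : Fin L,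
      ∫ x in (min t (node L m))..(min t (node L (m + 1))), p x := by
    rw [Fin.sum_univ_eq_sum_range (fun m : ℕ =>
      ∫ x in (min t (node L m))..(min t (node L (m + 1))), p x) L,
      intervalIntegral.sum_integral_adjacent_intervals (a := fun m : ℕ => min t (node L m))
        fun k _ => hp.intervalIntegrable _ _, node_zero, node_last hL, min_eq_left ht.2,
      min_eq_right ht.1]
    rfl
  rw [e]
  unfold stepCDF
  rw [← Finset.sum_sub_distrib, Finset.mul_sum]
  have e2 : 2 * A * step L = ∑ _m : Fin L, A * step L * step L := by
    rw [Finset.sum_const, Finset.card_univ, Fintype.card_fin, nsmul_eq_mul]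
    linear_combination (-A * step L) * mul_step hL
  rw [e2, ← Finset.sum_add_distrib]
  refine (Finset.abs_sum_le_sum_abs _ _).trans (Finset.sum_le_sum fun m _ => ?_)
  have hn : node L (m + 1) = node L m + step L := node_succ L m
  have hA := hp.const_nonneg
  rcases le_total t (node L m) with h | h
  · rw [min_eq_left h, min_eq_left (h.trans (by linarith))]
    simp only [sub_self, mul_zero, intervalIntegral.integral_same, abs_zero]
    positivity
  · rw [min_eq_right h]
    set r := min t (node L (m + 1)) with hr
    have r1 : node L m ≤ r := le_min h (by linarith)
    have r2 : r ≤ node L m + step L := (min_le_right _ _).trans hn.le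
    have h1 := hp.abs_mul_sub_integral_le le_rfl r1 r2
    have h2 : u m * (r - node L m) - ∫ x in (node L m)..r, p x =
      (u m - p (node L m)) * (r - node L m) +
        (p (node L m) * (r - node L m) - ∫ x in (node L m)..r, p x) := by ring
    rw [h2]
    refine (abs_add_le _ _).trans (add_le_add ?_ (h1.trans ?_))
    · rw [abs_mul, abs_of_nonneg (sub_nonneg.2 r1), mul_comm]
      exact mul_le_mul_of_nonneg_right (by linarith) (abs_nonneg _)
    · exact mul_le_mul_of_nonneg_left (by linarith) (by positivity)

/-- The CDF estimate at `t = 1`: it controls the normalizing factor. -/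
theorem IsLipDensity.abs_sum_sub_one_le (hp : IsLipDensity A p) {L : ℕ} (hL : 0 < L)
    (u : Fin L → ℝ) :
    |step L * ∑ m : Fin L, u m - 1| ≤
      step L * ∑ m : Fin L, |u m - p (node L m)| + 2 * A * step L := by
  have h := hp.abs_stepCDF_sub_le hL u (t := 1) (by norm_num)
  rw [hp.isUnitCDF.eq_one 1 le_rfl] at h
  have e : stepCDF L u 1 = step L * ∑ m : Fin L, u m := by
    unfold stepCDF
    rw [Finset.mul_sum]
    refine Finset.sum_congr rfl fun m _ => ?_
    rw [min_eq_right (node_mem_Icc hL m.2).2, min_eq_right (node_mem_Icc hL m.2.le).2, node_succ]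
    ring
  rwa [e] at h

theorem rawProfile_nonneg (L : ℕ) (y : Fin L → ℂ) (m : Fin L) : 0 ≤ rawProfile L y m :=
  le_max_left _ _

theorem isUnitCDF_profile {L : ℕ} (hL : 0 < L) {y : Fin L → ℂ}
    (hS : 0 < ∑ m, rawProfile L y m) : IsUnitCDF (stepCDF L (profile L y)) := by
  have hs := step_pos hL
  refine isUnitCDF_stepCDF hL (fun m => ?_) ?_
  · exact div_nonneg (rawProfile_nonneg L y m) (by positivity)
  · unfold profile
    rw [← Finset.sum_div]
    field_simp

/-- Division by the total mass `S` moves the profile by exactly `|S - 1|` in `L¹`, and this is at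
most `η + 2 * A * step L`. So normalization doubles both error terms. -/
theorem IsLipDensity.abs_profileCDF_sub_le (hp : IsLipDensity A p) {L : ℕ} (hL : 0 < L)
    {y : Fin L → ℂ} (hS : 0 < ∑ m, rawProfile L y m) {η : ℝ}
    (hη : step L * ∑ m : Fin L, |rawProfile L y m - p (node L m)| ≤ η)
    {t : ℝ} (ht : t ∈ Set.Icc (-1 : ℝ) 1) :
    |stepCDF L (profile L y) t - densityCDF p t| ≤ 2 * η + 4 * A * step L := by
  have hs := step_pos hL
  refine (hp.abs_stepCDF_sub_le hL _ ht).trans ?_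
  have h1 := hp.abs_sum_sub_one_le hL (rawProfile L y)
  set S := step L * ∑ m, rawProfile L y m with hSdef
  have hS' : 0 < S := by positivity
  have h2 : step L * ∑ m : Fin L, |profile L y m - p (node L m)| ≤
      step L * ∑ m : Fin L, |rawProfile L y m - p (node L m)| + |S - 1| := by
    have h3 : ∀ m, |profile L y m - p (node L m)| ≤
        |rawProfile L y m - p (node L m)| + rawProfile L y m * (|S - 1| / S) := by
      intro m
      have e : profile L y m - p (node L m) = (rawProfile L y m - p (node L m)) -
          rawProfile L y m * ((S - 1) / S) := by
        unfold profile
        rw [← hSdef]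
        field_simp
        ring
      rw [e]
      refine (abs_sub _ _).trans ?_
      rw [abs_mul, abs_div, abs_of_pos hS', abs_of_nonneg (rawProfile_nonneg L y m)]
    calc _ ≤ step L * ∑ m : Fin L, (|rawProfile L y m - p (node L m)| +
          rawProfile L y m * (|S - 1| / S)) := by gcongr with m; exact h3 m
      _ = step L * ∑ m : Fin L, |rawProfile L y m - p (node L m)| + S * (|S - 1| / S) := by
          rw [Finset.sum_add_distrib, ← Finset.sum_mul, hSdef]; ring
      _ = _ := by rw [mul_div_cancel₀ _ hS'.ne']
  linarith

/-- The error of the quadratic transport cost computed at one angle. -/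
theorem abs_discrete_cost_sub_le {q : ℝ → ℝ} (hp : IsLipDensity A p) (hq : IsLipDensity A q)
    {L : ℕ} (hL : 0 < L) {y z : Fin L → ℂ} {η : ℝ}
    (hy : step L * ∑ m : Fin L, |rawProfile L y m - p (node L m)| ≤ η)
    (hz : step L * ∑ m : Fin L, |rawProfile L z m - q (node L m)| ≤ η) :
    |1 / (L : ℝ) * ∑ j : Fin L, (discreteICDF L (cumSum L (profile L y)) ((j : ℝ) / L) -
        discreteICDF L (cumSum L (profile L z)) ((j : ℝ) / L)) ^ 2 -
      (crossCost (densityCDF p) (densityCDF q)).toReal| ≤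
      16 / L + 32 * η + 64 * A * step L := by
  have hs := step_pos hL
  have hA := hp.const_nonneg
  have hη : 0 ≤ η := le_trans (by positivity) hy
  have hLr : (0 : ℝ) < L := by exact_mod_cast hL
  -- If all raw values vanish, the mass defect is `1`, so the error bound itself must be at least of
  -- order one.
  have hdeg : ∀ (y : Fin L → ℂ) (p : ℝ → ℝ), IsLipDensity A p →
      step L * ∑ m : Fin L, |rawProfile L y m - p (node L m)| ≤ η →
      ¬ 0 < ∑ m, rawProfile L y m → 1 ≤ η + 2 * A * step L := by
    intro y p hp hy h
    have h0 : ∑ m, rawProfile L y m = 0 :=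
      le_antisymm (not_lt.1 h) (Finset.sum_nonneg fun m _ => rawProfile_nonneg L y m)
    have := hp.abs_sum_sub_one_le hL (rawProfile L y)
    rw [h0] at this
    norm_num at this
    linarith
  by_cases hyz : 0 < ∑ m, rawProfile L y m ∧ 0 < ∑ m, rawProfile L z m
  · have c1 := isUnitCDF_profile hL hyz.1
    have c2 := isUnitCDF_profile hL hyz.2
    have h1 := abs_riemann_sum_sub_crossCost_le c1 c2 hL
    have h2 := abs_crossCost_sub_le c1 c2 hp.isUnitCDF hq.isUnitCDF
      (fun t ht => hp.abs_profileCDF_sub_le hL hyz.1 hy ht)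
      (fun t ht => hq.abs_profileCDF_sub_le hL hyz.2 hz ht)
    simp only [discreteICDF_eq_quantile hL]
    refine (abs_sub_le _ _ _).trans ((add_le_add h1 h2).trans ?_)
    linarith
  -- In the degenerate case both costs lie in `[0, 4]`, and `4 ≤ 32 * (η + 2 * A * step L)`,
  -- whatever values the convention assigns.
  · have h1 : 1 ≤ η + 2 * A * step L := by
      rcases not_and_or.1 hyz with h | h
      exacts [hdeg y p hp hy h, hdeg z q hq hz h]
    have h2 := crossCost_toReal_le hp.isUnitCDF hq.isUnitCDF
    have h3 : (0 : ℝ) ≤ (crossCost (densityCDF p) (densityCDF q)).toReal := ENNReal.toReal_nonneg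
    have h4 : ∀ j : Fin L, (discreteICDF L (cumSum L (profile L y)) ((j : ℝ) / L) -
        discreteICDF L (cumSum L (profile L z)) ((j : ℝ) / L)) ^ 2 ≤ 4 :=
      fun j => sq_quantile_sub_le _ _ _
    have h5 := Finset.sum_le_sum fun j (_ : j ∈ Finset.univ) => h4 j
    have h6 : (0 : ℝ) ≤ ∑ j : Fin L, (discreteICDF L (cumSum L (profile L y)) ((j : ℝ) / L) -
        discreteICDF L (cumSum L (profile L z)) ((j : ℝ) / L)) ^ 2 :=
      Finset.sum_nonneg fun j _ => sq_nonneg _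
    rw [Finset.sum_const, Finset.card_univ, Fintype.card_fin, nsmul_eq_mul] at h5
    have h7 : 1 / (L : ℝ) * ∑ j : Fin L, (discreteICDF L (cumSum L (profile L y)) ((j : ℝ) / L) -
        discreteICDF L (cumSum L (profile L z)) ((j : ℝ) / L)) ^ 2 ≤ 4 := by
      rw [one_div, inv_mul_le_iff₀ hLr]; exact h5
    have h8 : 0 ≤ 1 / (L : ℝ) * ∑ j : Fin L, (discreteICDF L (cumSum L (profile L y)) ((j : ℝ) / L) -
        discreteICDF L (cumSum L (profile L z)) ((j : ℝ) / L)) ^ 2 := by positivity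
    have h9 : 0 ≤ 16 / (L : ℝ) := by positivity
    have h10 : 0 ≤ A * step L := by positivity
    rw [abs_le]
    constructor <;> linarith

end LipDensity

/-! ### Trigonometric interpolation on the grid -/

/-- The character `s ↦ exp (i π q s)` of `ℝ / 2ℤ`. -/
noncomputable def character (q : ℤ) (s : ℝ) : ℂ :=
  Complex.exp (Complex.I * (q : ℂ) * (Real.pi : ℂ) * (s : ℂ))

theorem character_add (q : ℤ) (s t : ℝ) :
    character q (s + t) = character q s * character q t := by
  unfold character
  rw [← Complex.exp_add]
  push_cast
  ring_nf

theorem character_eq (q : ℤ) (s : ℝ) :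
    character q s = Complex.exp (Complex.I * ((q * Real.pi * s : ℝ) : ℂ)) := by
  unfold character
  push_cast
  ring_nf

theorem norm_character (q : ℤ) (s : ℝ) : ‖character q s‖ = 1 := by
  rw [character_eq, Complex.norm_exp_I_mul_ofReal]

theorem star_character (q : ℤ) (s : ℝ) : star (character q s) = character (-q) s := by
  unfold character
  rw [Complex.star_def, ← Complex.exp_conj]
  simp

theorem character_add_left (q r : ℤ) (s : ℝ) :
    character (q + r) s = character q s * character r s := by
  unfold character
  rw [← Complex.exp_add]
  push_cast
  ring_nf

theorem character_two (q : ℤ) : character q 2 = 1 := by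
  unfold character
  rw [Complex.exp_eq_one_iff]
  exact ⟨q, by push_cast; ring⟩

theorem character_zero_left (s : ℝ) : character 0 s = 1 := by simp [character]

theorem character_nat_mul (q : ℤ) (n : ℕ) (s : ℝ) : character q (n * s) = character q s ^ n := by
  unfold character
  rw [← Complex.exp_nat_mul]
  push_cast
  ring_nf

theorem continuous_character (q : ℤ) : Continuous (character q) := by
  unfold character; fun_prop

theorem character_step_ne_one {L : ℕ} (hL : 0 < L) {q : ℤ} (hq : ¬ (L : ℤ) ∣ q) :
    character q (step L) ≠ 1 := by
  have hL' : (L : ℂ) ≠ 0 := by exact_mod_cast hL.ne'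
  unfold character step
  rw [Ne, Complex.exp_eq_one_iff]
  rintro ⟨n, hn⟩
  refine hq ⟨n, ?_⟩
  push_cast at hn
  field_simp at hn
  exact_mod_cast hn

theorem sum_character_node {L : ℕ} (hL : 0 < L) {q : ℤ} (hq : ¬ (L : ℤ) ∣ q) :
    ∑ m : Fin L, character q (node L m) = 0 := by
  have h1 : ∀ m : ℕ, character q (node L m) = character q (-1) * character q (step L) ^ m := by
    intro m
    unfold node
    rw [character_add, character_nat_mul]
  simp only [h1]
  rw [← Finset.mul_sum, Fin.sum_univ_eq_sum_range (fun m => character q (step L) ^ m) L,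
    geom_sum_eq (character_step_ne_one hL hq), ← character_nat_mul, mul_step hL, character_two]
  simp

/-- The frequencies are `L` consecutive integers, hence distinct modulo `L`. This is what makes the
sampled characters orthogonal. -/
theorem freq_injective_mod {L : ℕ} {i j : Fin L} (h : (L : ℤ) ∣ freq L i - freq L j) : i = j := by
  unfold freq at h
  have h1 : ((i : ℕ) : ℤ) - ((j : ℕ) : ℤ) = 0 := by
    refine Int.eq_zero_of_abs_lt_dvd (m := (L : ℤ)) (by simpa using h) ?_
    have := i.2
    have := j.2
    rw [abs_lt]; constructor <;> omega
  ext; omega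

/-- The matrix of the characters with frequencies `freq L j`, sampled at the grid points. -/
noncomputable def characterMatrix (L : ℕ) : Matrix (Fin L) (Fin L) ℂ :=
  Matrix.of fun m j => character (freq L j) (node L m)

open scoped Matrix in
theorem conjTranspose_mul_characterMatrix {L : ℕ} (hL : 0 < L) :
    (characterMatrix L)ᴴ * characterMatrix L = (L : ℂ) • 1 := by
  ext i j
  rw [Matrix.mul_apply]
  simp only [Matrix.conjTranspose_apply, characterMatrix, Matrix.of_apply, star_character,
    ← character_add_left, Matrix.smul_apply, Matrix.one_apply]
  split_ifs with h
  · subst h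
    simp [character_zero_left]
  · rw [sum_character_node hL]
    · simp
    · intro hd
      refine h (freq_injective_mod ?_).symm
      rwa [neg_add_eq_sub] at hd

open scoped Matrix in
theorem characterMatrix_mul_conjTranspose {L : ℕ} (hL : 0 < L) :
    characterMatrix L * (characterMatrix L)ᴴ = (L : ℂ) • 1 := by
  have hL' : (L : ℂ) ≠ 0 := by exact_mod_cast hL.ne'
  have h1 : ((L : ℂ)⁻¹ • (characterMatrix L)ᴴ) * characterMatrix L = 1 := by
    rw [Matrix.smul_mul, conjTranspose_mul_characterMatrix hL, smul_smul, inv_mul_cancel₀ hL',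
      one_smul]
  have h2 := mul_eq_one_comm.1 h1
  rw [Matrix.mul_smul] at h2
  rw [← h2, smul_smul, mul_inv_cancel₀ hL', one_smul]

/-! ### Discrete Parseval identity -/

/-- The `ℓ²` norm of a finite family of complex numbers. -/
noncomputable def l2norm {L : ℕ} (v : Fin L → ℂ) : ℝ :=
  ‖(WithLp.toLp 2 v : EuclideanSpace ℂ (Fin L))‖

theorem l2norm_eq {L : ℕ} (v : Fin L → ℂ) : l2norm v = Real.sqrt (∑ i, ‖v i‖ ^ 2) :=
  EuclideanSpace.norm_eq _

theorem l2norm_sq {L : ℕ} (v : Fin L → ℂ) : l2norm v ^ 2 = ∑ i, ‖v i‖ ^ 2 :=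
  EuclideanSpace.norm_sq_eq _

theorem l2norm_nonneg {L : ℕ} (v : Fin L → ℂ) : 0 ≤ l2norm v := norm_nonneg _

theorem l2norm_add_le {L : ℕ} (v w : Fin L → ℂ) : l2norm (v + w) ≤ l2norm v + l2norm w :=
  norm_add_le (WithLp.toLp 2 v : EuclideanSpace ℂ (Fin L)) _

theorem l2norm_smul {L : ℕ} (c : ℂ) (v : Fin L → ℂ) : l2norm (c • v) = ‖c‖ * l2norm v :=
  norm_smul c (WithLp.toLp 2 v : EuclideanSpace ℂ (Fin L))

theorem l2norm_mono {L : ℕ} {v w : Fin L → ℂ} (h : ∀ i, ‖v i‖ ≤ ‖w i‖) : l2norm v ≤ l2norm w := by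
  rw [l2norm_eq, l2norm_eq]
  exact Real.sqrt_le_sqrt (Finset.sum_le_sum fun i _ => by gcongr; exact h i)

theorem l2norm_le_of_forall {L : ℕ} {v : Fin L → ℂ} {D : ℝ} (hD : 0 ≤ D) (h : ∀ i, ‖v i‖ ≤ D) :
    l2norm v ≤ Real.sqrt L * D := by
  rw [l2norm_eq, ← Real.sqrt_sq hD, ← Real.sqrt_mul (Nat.cast_nonneg L)]
  refine Real.sqrt_le_sqrt ?_
  calc ∑ i, ‖v i‖ ^ 2 ≤ ∑ _i : Fin L, D ^ 2 := Finset.sum_le_sum fun i _ => by gcongr; exact h i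
    _ = L * D ^ 2 := by simp

theorem sum_norm_le_l2norm {L : ℕ} (v : Fin L → ℂ) : ∑ i, ‖v i‖ ≤ Real.sqrt L * l2norm v := by
  rw [l2norm_eq, ← Real.sqrt_mul (Nat.cast_nonneg L)]
  refine Real.le_sqrt_of_sq_le ?_
  simpa using sq_sum_le_card_mul_sum_sq (s := Finset.univ) (f := fun i => ‖v i‖)

open scoped Matrix in
theorem l2norm_sq_mulVec {L : ℕ} {M : Matrix (Fin L) (Fin L) ℂ} (hM : Mᴴ * M = (L : ℂ) • 1)
    (c : Fin L → ℂ) : l2norm (M *ᵥ c) = Real.sqrt L * l2norm c := by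
  have key : ∀ v : Fin L → ℂ, ((l2norm v ^ 2 : ℝ) : ℂ) = star v ⬝ᵥ v := by
    intro v
    rw [l2norm_sq]
    push_cast
    refine Finset.sum_congr rfl fun i _ => ?_
    rw [Pi.star_apply, Complex.star_def, Complex.conj_mul']
  have h1 : ((l2norm (M *ᵥ c) ^ 2 : ℝ) : ℂ) = ((L * l2norm c ^ 2 : ℝ) : ℂ) := by
    rw [Complex.ofReal_mul, key, key, Matrix.star_mulVec, Matrix.dotProduct_mulVec,
      Matrix.vecMul_vecMul, hM, ← Matrix.dotProduct_mulVec, Matrix.smul_mulVec, Matrix.one_mulVec,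
      dotProduct_smul, smul_eq_mul]
    simp
  have h2 : l2norm (M *ᵥ c) ^ 2 = L * l2norm c ^ 2 := by exact_mod_cast h1
  rw [← Real.sqrt_sq (l2norm_nonneg (M *ᵥ c)), h2, Real.sqrt_mul (Nat.cast_nonneg L),
    Real.sqrt_sq (l2norm_nonneg c)]

open scoped Matrix in
theorem trigPoly_eq {L : ℕ} (y : Fin L → ℂ) (s : ℝ) :
    trigPoly L y s = ∑ j, character (freq L j) s * ((1 / 2 : ℂ) • y) j := by
  unfold trigPoly character
  refine Finset.sum_congr rfl fun j _ => ?_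
  rw [Pi.smul_apply, smul_eq_mul, mul_comm]

open scoped Matrix in
theorem l2norm_trigPoly {L : ℕ} (hL : 0 < L) (y : Fin L → ℂ) :
    l2norm (fun m : Fin L => trigPoly L y (node L m)) = Real.sqrt L * (1 / 2 * l2norm y) := by
  have : (fun m : Fin L => trigPoly L y (node L m)) = characterMatrix L *ᵥ ((1 / 2 : ℂ) • y) := by
    ext m
    rw [trigPoly_eq]
    rfl
  rw [this, l2norm_sq_mulVec (conjTranspose_mul_characterMatrix hL), l2norm_smul]
  norm_num

/-- The chord `2 |sin (a / 2)|` increases with `|a|` up to `π`. Squares of sines are traded for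
cosines of the full angle, which decrease on `[0, π]`. -/
theorem norm_exp_sub_one_le {a b : ℝ} (hab : |a| ≤ |b|) (hb : |b| ≤ Real.pi) :
    ‖Complex.exp (Complex.I * (a : ℂ)) - 1‖ ≤ ‖Complex.exp (Complex.I * (b : ℂ)) - 1‖ := by
  rw [Complex.norm_exp_I_mul_ofReal_sub_one, Complex.norm_exp_I_mul_ofReal_sub_one, norm_mul,
    norm_mul]
  refine mul_le_mul_of_nonneg_left ?_ (norm_nonneg _)
  rw [Real.norm_eq_abs, Real.norm_eq_abs, ← sq_le_sq, Real.sin_sq, Real.sin_sq, Real.cos_sq,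
    Real.cos_sq, mul_div_cancel₀ _ two_ne_zero, mul_div_cancel₀ _ two_ne_zero, ← Real.cos_abs a,
    ← Real.cos_abs b]
  have := Real.cos_le_cos_of_nonneg_of_le_pi (abs_nonneg a) hb hab
  linarith

theorem abs_freq_le {L : ℕ} (j : Fin L) : |(freq L j : ℝ)| ≤ L / 2 := by
  have h1 : -(L : ℤ) ≤ 2 * freq L j ∧ 2 * freq L j ≤ L := by
    unfold freq
    have := j.2
    constructor <;> omega
  have h2 : -(L : ℝ) ≤ 2 * freq L j := by exact_mod_cast h1.1
  have h3 : 2 * (freq L j : ℝ) ≤ L := by exact_mod_cast h1.2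
  rw [abs_le]; constructor <;> linarith

/-- Because `|freq L j| ≤ L / 2` and `L * step L = 2`, the phase of a full grid step stays within
`π`, where chords are monotone. A fractional shift is thus dominated by a full step, which acts on
grid samples as a cyclic shift. -/
theorem norm_character_sub_one_le {L : ℕ} (hL : 0 < L) (j : Fin L) {δ : ℝ} (h0 : 0 ≤ δ)
    (h1 : δ ≤ step L) :
    ‖character (-freq L j) δ - 1‖ ≤ ‖character (freq L j) (step L) - 1‖ := by
  have hs := step_pos hL
  rw [character_eq, character_eq]
  have hpi := Real.pi_pos
  refine norm_exp_sub_one_le ?_ ?_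
  · push_cast
    rw [abs_mul, abs_mul, abs_mul, abs_mul, abs_neg, abs_of_nonneg h0, abs_of_pos hs]
    gcongr
  · rw [abs_mul, abs_mul, abs_of_pos hs, abs_of_pos hpi]
    calc _ ≤ (L / 2 : ℝ) * Real.pi * step L := by gcongr; exact abs_freq_le j
      _ = Real.pi := by linear_combination (Real.pi / 2) * mul_step hL

/-! ### Fourier integrals versus discrete Fourier coefficients -/

section Interpolation

variable {L : ℕ} {P : ℝ → ℝ} {D : ℝ}

open scoped Matrix in
/-- The discrete Fourier coefficients of the samples of `P` at the grid points shifted by `δ`. -/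
noncomputable def shiftedDFT (L : ℕ) (P : ℝ → ℝ) (δ : ℝ) : Fin L → ℂ :=
  (L : ℂ)⁻¹ • ((characterMatrix L)ᴴ *ᵥ fun m : Fin L => ((P (node L m + δ) : ℝ) : ℂ))

theorem shiftedDFT_apply (δ : ℝ) (j : Fin L) : shiftedDFT L P δ j =
    (L : ℂ)⁻¹ * ∑ m : Fin L, character (-freq L j) (node L m) * ((P (node L m + δ) : ℝ) : ℂ) := by
  unfold shiftedDFT
  rw [Pi.smul_apply, smul_eq_mul]
  congr 1
  simp only [Matrix.mulVec, dotProduct]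
  refine Finset.sum_congr rfl fun m _ => ?_
  rw [Matrix.conjTranspose_apply, characterMatrix, Matrix.of_apply, star_character]

open scoped Matrix in
theorem mulVec_shiftedDFT (hL : 0 < L) (δ : ℝ) :
    characterMatrix L *ᵥ shiftedDFT L P δ = fun m : Fin L => ((P (node L m + δ) : ℝ) : ℂ) := by
  have hL' : (L : ℂ) ≠ 0 := by exact_mod_cast hL.ne'
  unfold shiftedDFT
  rw [Matrix.mulVec_smul, Matrix.mulVec_mulVec, characterMatrix_mul_conjTranspose hL,
    Matrix.smul_mulVec, Matrix.one_mulVec, smul_smul, inv_mul_cancel₀ hL', one_smul]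

open scoped Matrix in
-- The character matrix is `√L` times an isometry, and `L` values bounded by `D` have `ℓ²` norm at
-- most `√L * D`.
theorem l2norm_le_of_mulVec (hL : 0 < L) (hD : 0 ≤ D) {c : Fin L → ℂ}
    (h : ∀ m, ‖(characterMatrix L *ᵥ c) m‖ ≤ D) : l2norm c ≤ D := by
  have h1 := l2norm_le_of_forall hD h
  rw [l2norm_sq_mulVec (conjTranspose_mul_characterMatrix hL)] at h1
  have hL' : (0 : ℝ) < L := by exact_mod_cast hL
  exact le_of_mul_le_mul_left h1 (Real.sqrt_pos.2 hL')

open scoped Matrix in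
-- Multiplication of the coefficients by `character (freq L j) (step L) - 1` is the cyclic forward
-- difference of the samples, and each difference is at most `D`.
theorem l2norm_modulation_le (hL : 0 < L) (hD : 0 ≤ D) (hper : P 1 = P (-1))
    (hlip : ∀ m : Fin L, ∀ δ ∈ Set.Icc 0 (step L), |P (node L m + δ) - P (node L m)| ≤ D) :
    l2norm (fun j => (character (freq L j) (step L) - 1) * shiftedDFT L P 0 j) ≤ D := by
  refine l2norm_le_of_mulVec hL hD fun m => ?_
  have h0 : ∀ k : Fin L, ∑ j, character (freq L j) (node L k) * shiftedDFT L P 0 j =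
      ((P (node L k) : ℝ) : ℂ) := by
    intro k
    have := congrFun (mulVec_shiftedDFT (P := P) hL 0) k
    rw [add_zero] at this
    exact this
  have hnext : ∑ j, character (freq L j) (node L (m + 1)) * shiftedDFT L P 0 j =
      ((P (node L (m + 1)) : ℝ) : ℂ) := by
    rcases lt_or_eq_of_le (Nat.succ_le_of_lt m.2) with h | h
    · exact h0 ⟨m + 1, h⟩
    -- At the last node the shift wraps around: the characters have period `2`, and `P 1 = P (-1)`
    -- makes the samples agree.
    · have e : ∀ j : Fin L, character (freq L j) (1 : ℝ) = character (freq L j) (-1) := by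
        intro j
        have h2 := character_add (freq L j) (-1) 2
        rw [character_two, mul_one] at h2
        rw [← h2]; norm_num
      have h1 := h0 ⟨0, hL⟩
      simp only [node_zero] at h1
      have h' : (m : ℕ) + 1 = L := h
      simp only [h', node_last hL, e]
      rw [h1, hper]
  have e : (characterMatrix L *ᵥ fun j => (character (freq L j) (step L) - 1) *
      shiftedDFT L P 0 j) m = ((P (node L (m + 1)) - P (node L m) : ℝ) : ℂ) := by
    rw [Complex.ofReal_sub, ← hnext, ← h0 m, ← Finset.sum_sub_distrib]
    simp only [Matrix.mulVec, dotProduct]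
    refine Finset.sum_congr rfl fun j _ => ?_
    rw [node_succ, character_add, characterMatrix, Matrix.of_apply]
    ring
  rw [e, Complex.norm_real, Real.norm_eq_abs, node_succ]
  exact hlip m _ ⟨(step_pos hL).le, le_rfl⟩

/-- Two errors of size `D`: the samples are displaced by `δ` within their cells, and the phase
`character (-freq L j) δ` differs from `1`. The second is dominated by the phase of a full grid
step, that is, by the forward difference. -/
theorem l2norm_shiftedDFT_sub_le (hL : 0 < L) (hD : 0 ≤ D) (hper : P 1 = P (-1))
    (hlip : ∀ m : Fin L, ∀ δ ∈ Set.Icc 0 (step L), |P (node L m + δ) - P (node L m)| ≤ D)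
    {δ : ℝ} (hδ : δ ∈ Set.Icc 0 (step L)) :
    l2norm (fun j => character (-freq L j) δ * shiftedDFT L P δ j - shiftedDFT L P 0 j) ≤
      2 * D := by
  have e : (fun j => character (-freq L j) δ * shiftedDFT L P δ j - shiftedDFT L P 0 j) =
      (fun j => character (-freq L j) δ * (shiftedDFT L P δ j - shiftedDFT L P 0 j)) +
      fun j => (character (-freq L j) δ - 1) * shiftedDFT L P 0 j := by
    ext j
    simp only [Pi.add_apply]
    ring
  rw [e, two_mul]
  refine (l2norm_add_le _ _).trans (add_le_add ?_ ?_)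
  · refine (l2norm_mono (w := shiftedDFT L P δ - shiftedDFT L P 0) fun j => ?_).trans ?_
    · rw [norm_mul, norm_character, one_mul, Pi.sub_apply]
    · refine l2norm_le_of_mulVec hL hD fun m => ?_
      rw [Matrix.mulVec_sub, Pi.sub_apply, mulVec_shiftedDFT hL, mulVec_shiftedDFT hL]
      simp only [add_zero]
      rw [← Complex.ofReal_sub, Complex.norm_real]
      exact hlip m δ hδ
  · refine (l2norm_mono fun j => ?_).trans (l2norm_modulation_le hL hD hper hlip)
    rw [norm_mul, norm_mul]
    exact mul_le_mul_of_nonneg_right (norm_character_sub_one_le hL j hδ.1 hδ.2) (norm_nonneg _)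

theorem intervalIntegrable_ofReal {f : ℝ → ℝ} {a b : ℝ} (h : IntervalIntegrable f volume a b) :
    IntervalIntegrable (fun x => ((f x : ℝ) : ℂ)) volume a b :=
  ⟨Integrable.ofReal h.1, Integrable.ofReal h.2⟩

theorem intervalIntegrable_shift (hL : 0 < L) (hP : IntervalIntegrable P volume (-1) 1)
    (m : Fin L) : IntervalIntegrable (fun δ => P (node L m + δ)) volume 0 (step L) := by
  have h1 : IntervalIntegrable P volume (node L m) (node L (m + 1)) := by
    refine hP.mono_set ?_
    rw [Set.uIcc_of_le (node_mono hL (Nat.le_succ _)), Set.uIcc_of_le (by norm_num)]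
    exact Set.Icc_subset_Icc (node_mem_Icc hL m.2.le).1 (node_mem_Icc hL m.2).2
  have := h1.comp_add_left (node L m)
  rwa [sub_self, node_succ, add_sub_cancel_left] at this

theorem intervalIntegrable_shiftedDFT (hL : 0 < L) (hP : IntervalIntegrable P volume (-1) 1)
    (j : Fin L) :
    IntervalIntegrable (fun δ => character (-freq L j) δ * shiftedDFT L P δ j) volume
      0 (step L) := by
  simp only [shiftedDFT_apply]
  refine IntervalIntegrable.continuousOn_mul (IntervalIntegrable.const_mul ?_ _)
    (continuous_character _).continuousOn
  have := IntervalIntegrable.sum (μ := volume) (a := 0) (b := step L) Finset.univ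
    (f := fun (m : Fin L) δ =>
      character (-freq L j) (node L m) * ((P (node L m + δ) : ℝ) : ℂ)) (fun m _ =>
      IntervalIntegrable.const_mul
        (intervalIntegrable_ofReal (intervalIntegrable_shift hL hP m)) _)
  exact this.congr fun δ _ => by simp

/-- The integral is cut into grid cells. With `s = node L m + δ` the character factors, and the sum
over `m` at fixed `δ` is a discrete Fourier transform. -/
theorem integral_character_eq (hL : 0 < L) (hP : IntervalIntegrable P volume (-1) 1) (j : Fin L) :
    ∫ s in (-1 : ℝ)..1, ((P s : ℝ) : ℂ) * character (-freq L j) s =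
      L * ∫ δ in (0 : ℝ)..step L, character (-freq L j) δ * shiftedDFT L P δ j := by
  have hL' : (L : ℂ) ≠ 0 := by exact_mod_cast hL.ne'
  set φ : ℝ → ℂ := fun s => ((P s : ℝ) : ℂ) * character (-freq L j) s with hφ
  have hφi : IntervalIntegrable φ volume (-1) 1 :=
    IntervalIntegrable.mul_continuousOn (intervalIntegrable_ofReal hP)
      (continuous_character _).continuousOn
  have hsub : ∀ m < L, IntervalIntegrable φ volume (node L m) (node L (m + 1)) := by
    intro m hm
    refine hφi.mono_set ?_
    rw [Set.uIcc_of_le (node_mono hL (Nat.le_succ _)), Set.uIcc_of_le (by norm_num)]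
    exact Set.Icc_subset_Icc (node_mem_Icc hL hm.le).1 (node_mem_Icc hL hm).2
  have hsum := intervalIntegral.sum_integral_adjacent_intervals hsub
  rw [node_zero, node_last hL] at hsum
  rw [← hsum, ← intervalIntegral.integral_const_mul,
    ← Fin.sum_univ_eq_sum_range (fun m : ℕ => ∫ s in (node L m)..(node L (m + 1)), φ s) L]
  have e1 : ∀ m : Fin L, ∫ s in (node L m)..(node L (m + 1)), φ s =
      ∫ δ in (0 : ℝ)..step L, φ (node L m + δ) := by
    intro m
    rw [intervalIntegral.integral_comp_add_left, add_zero, node_succ]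
  simp only [e1]
  rw [← intervalIntegral.integral_finsetSum]
  · congr 1
    ext δ
    rw [shiftedDFT_apply, mul_left_comm, mul_inv_cancel_left₀ hL', Finset.mul_sum]
    refine Finset.sum_congr rfl fun m _ => ?_
    simp only [hφ, character_add]
    ring
  · intro m _
    have := (hsub m m.2).comp_add_left (node L m)
    rwa [sub_self, node_succ, add_sub_cancel_left] at this

/-- Since `L / 2 = 1 / step L`, half the Fourier integrals form the mean over `δ` of modulated
shifted transforms. The norm of the mean deviation is at most the supremum of the deviations.
Aliasing is included, and `P` may jump between cells or inside them as long as the jumps are of size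
`D`. -/
theorem l2norm_fourier_sub_le (hL : 0 < L) (hD : 0 ≤ D) (hper : P 1 = P (-1))
    (hP : IntervalIntegrable P volume (-1) 1)
    (hlip : ∀ m : Fin L, ∀ δ ∈ Set.Icc 0 (step L), |P (node L m + δ) - P (node L m)| ≤ D)
    {y : Fin L → ℂ}
    (hy : ∀ j, y j = ∫ s in (-1 : ℝ)..1, ((P s : ℝ) : ℂ) * character (-freq L j) s) :
    l2norm ((1 / 2 : ℂ) • y - shiftedDFT L P 0) ≤ 2 * D := by
  have hs := step_pos hL
  set W : ℝ → EuclideanSpace ℂ (Fin L) := fun δ => WithLp.toLp 2 fun j =>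
    character (-freq L j) δ * shiftedDFT L P δ j - shiftedDFT L P 0 j with hW
  have hWj : ∀ j, IntervalIntegrable (fun δ => W δ j) volume 0 (step L) := fun j =>
    (intervalIntegrable_shiftedDFT hL hP j).sub intervalIntegrable_const
  have hWi : IntervalIntegrable W volume 0 (step L) := by
    rw [intervalIntegrable_iff]
    exact Integrable.of_eval_piLp fun j => intervalIntegrable_iff.1 (hWj j)
  have e : (WithLp.toLp 2 ((1 / 2 : ℂ) • y - shiftedDFT L P 0) : EuclideanSpace ℂ (Fin L)) =
      (step L)⁻¹ • ∫ δ in (0 : ℝ)..step L, W δ := by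
    ext j
    have h1 : (∫ δ in (0 : ℝ)..step L, W δ) j = ∫ δ in (0 : ℝ)..step L, W δ j :=
      ((EuclideanSpace.proj (𝕜 := ℂ) j).intervalIntegral_comp_comm hWi).symm
    have hsc : (step L : ℂ) ≠ 0 := by exact_mod_cast hs.ne'
    have h2 : (L : ℂ) * step L = 2 := by exact_mod_cast mul_step hL
    rw [PiLp.smul_apply, h1]
    simp only [hW]
    rw [intervalIntegral.integral_sub (intervalIntegrable_shiftedDFT hL hP j)
      intervalIntegrable_const, intervalIntegral.integral_const, sub_zero, smul_sub, smul_smul,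
      inv_mul_cancel₀ hs.ne', one_smul, Pi.sub_apply, Pi.smul_apply, hy,
      integral_character_eq hL hP, smul_eq_mul, Complex.real_smul]
    congr 1
    push_cast
    field_simp
    linear_combination (∫ δ in (0 : ℝ)..step L,
      character (-freq L j) δ * shiftedDFT L P δ j) * h2
  unfold l2norm
  rw [e, norm_smul, Real.norm_of_nonneg (inv_nonneg.2 hs.le), inv_mul_le_iff₀ hs]
  refine (intervalIntegral.norm_integral_le_of_norm_le_const (C := 2 * D) fun δ hδ => ?_).trans ?_
  · rw [Set.uIoc_of_le hs.le] at hδ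
    exact l2norm_shiftedDFT_sub_le hL hD hper hlip ⟨hδ.1.le, hδ.2⟩
  · rw [sub_zero, abs_of_pos hs, mul_comm]

/-- Trigonometric interpolation from approximate Fourier samples of a function that varies little
over a grid cell. -/
theorem l2norm_trigPoly_sub_le (hL : 0 < L) (hD : 0 ≤ D) (hper : P 1 = P (-1))
    (hP : IntervalIntegrable P volume (-1) 1)
    (hlip : ∀ m : Fin L, ∀ δ ∈ Set.Icc 0 (step L), |P (node L m + δ) - P (node L m)| ≤ D)
    {B ε : ℝ} (hB : ∀ m : Fin L, |P (node L m)| ≤ B) (hB0 : 0 ≤ B) (hε : 0 ≤ ε)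
    {y Y : Fin L → ℂ}
    (hy : ∀ j, y j = ∫ s in (-1 : ℝ)..1, ((P s : ℝ) : ℂ) * character (-freq L j) s)
    (hY : l2norm (Y - y) ≤ ε * l2norm y) :
    l2norm (fun m : Fin L => trigPoly L Y (node L m) - ((P (node L m) : ℝ) : ℂ)) ≤
      Real.sqrt L * (2 * D + ε * (B + 2 * D)) := by
  have h1 : l2norm (fun m : Fin L => trigPoly L y (node L m) - ((P (node L m) : ℝ) : ℂ)) ≤
      Real.sqrt L * (2 * D) := by
    have e : (fun m : Fin L => trigPoly L y (node L m) - ((P (node L m) : ℝ) : ℂ)) =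
        Matrix.mulVec (characterMatrix L) ((1 / 2 : ℂ) • y - shiftedDFT L P 0) := by
      rw [Matrix.mulVec_sub, mulVec_shiftedDFT hL]
      ext m
      rw [trigPoly_eq, Pi.sub_apply, add_zero]
      rfl
    rw [e, l2norm_sq_mulVec (conjTranspose_mul_characterMatrix hL)]
    exact mul_le_mul_of_nonneg_left (l2norm_fourier_sub_le hL hD hper hP hlip hy)
      (Real.sqrt_nonneg _)
  have h2 : l2norm (fun m : Fin L => trigPoly L y (node L m)) ≤
      Real.sqrt L * (B + 2 * D) := by
    have e : (fun m : Fin L => trigPoly L y (node L m)) =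
        (fun m : Fin L => ((P (node L m) : ℝ) : ℂ)) +
        fun m : Fin L => trigPoly L y (node L m) - ((P (node L m) : ℝ) : ℂ) := by
      ext m; simp
    rw [e, mul_add]
    refine (l2norm_add_le _ _).trans (add_le_add (l2norm_le_of_forall hB0 fun m => ?_) h1)
    rw [Complex.norm_real]
    exact hB m
  -- The NUFFT error is relative to `l2norm y`, which by Parseval is determined by the node values
  -- of the exact polynomial, bounded in `h2`.
  have h3 : l2norm (fun m : Fin L => trigPoly L (Y - y) (node L m)) ≤
      Real.sqrt L * (ε * (B + 2 * D)) := by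
    rw [l2norm_trigPoly hL] at h2 ⊢
    calc _ ≤ Real.sqrt L * (1 / 2 * (ε * l2norm y)) := by gcongr
      _ = ε * (Real.sqrt L * (1 / 2 * l2norm y)) := by ring
      _ ≤ ε * (Real.sqrt L * (B + 2 * D)) := by gcongr
      _ = _ := by ring
  have e : (fun m : Fin L => trigPoly L Y (node L m) - ((P (node L m) : ℝ) : ℂ)) =
      (fun m : Fin L => trigPoly L y (node L m) - ((P (node L m) : ℝ) : ℂ)) +
      fun m : Fin L => trigPoly L (Y - y) (node L m) := by
    ext m
    have : trigPoly L (Y - y) (node L m) = trigPoly L Y (node L m) - trigPoly L y (node L m) := by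
      unfold trigPoly
      rw [← Finset.sum_sub_distrib]
      refine Finset.sum_congr rfl fun j _ => ?_
      rw [Pi.sub_apply]; ring
    rw [Pi.add_apply, this]; ring
  rw [e, mul_add]
  exact (l2norm_add_le _ _).trans (add_le_add h1 h3)

/-- The error of the discrete line projection before normalization. -/
theorem sum_abs_rawProfile_sub_le (hL : 0 < L) (hD : 0 ≤ D) (hper : P 1 = P (-1))
    (hP : IntervalIntegrable P volume (-1) 1)
    (hlip : ∀ m : Fin L, ∀ δ ∈ Set.Icc 0 (step L), |P (node L m + δ) - P (node L m)| ≤ D)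
    {B ε : ℝ} (hB : ∀ m : Fin L, |P (node L m)| ≤ B) (hB0 : 0 ≤ B) (hε : 0 ≤ ε)
    {y Y : Fin L → ℂ}
    (hy : ∀ j, y j = ∫ s in (-1 : ℝ)..1, ((P s : ℝ) : ℂ) * character (-freq L j) s)
    (hY : l2norm (Y - y) ≤ ε * l2norm y) {p : ℝ → ℝ} (hp : ∀ x, 0 ≤ p x)
    (hPp : ∀ m : Fin L, |P (node L m) - p (node L m)| ≤ D) :
    step L * ∑ m : Fin L, |rawProfile L Y m - p (node L m)| ≤
      2 * (3 * D + ε * (B + 2 * D)) := by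
  have hs := step_pos hL
  have hterm : ∀ m : Fin L, |rawProfile L Y m - p (node L m)| ≤
      ‖trigPoly L Y (node L m) - ((P (node L m) : ℝ) : ℂ)‖ + D := by
    intro m
    -- Since `p ≥ 0`, clipping at `0` is a contraction that fixes `p (node L m)`.
    have h1 : |rawProfile L Y m - p (node L m)| ≤
        |(trigPoly L Y (node L m)).re - p (node L m)| := by
      have := abs_max_sub_max_le_abs (trigPoly L Y (node L m)).re (p (node L m)) 0
      rwa [max_comm, max_eq_left (hp _)] at this
    have h2 : |(trigPoly L Y (node L m)).re - P (node L m)| ≤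
        ‖trigPoly L Y (node L m) - ((P (node L m) : ℝ) : ℂ)‖ := by
      simpa using Complex.abs_re_le_norm (trigPoly L Y (node L m) - ((P (node L m) : ℝ) : ℂ))
    exact h1.trans ((abs_sub_le _ _ _).trans (add_le_add h2 (hPp m)))
  have h1 := sum_norm_le_l2norm
    (fun m : Fin L => trigPoly L Y (node L m) - ((P (node L m) : ℝ) : ℂ))
  have h2 := l2norm_trigPoly_sub_le hL hD hper hP hlip hB hB0 hε hy hY
  have h3 : ∑ m : Fin L, |rawProfile L Y m - p (node L m)| ≤
      L * (2 * D + ε * (B + 2 * D)) + L * D := by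
    refine (Finset.sum_le_sum fun m _ => hterm m).trans ?_
    rw [Finset.sum_add_distrib]
    refine add_le_add (h1.trans ((mul_le_mul_of_nonneg_left h2 (Real.sqrt_nonneg _)).trans ?_)) ?_
    · rw [← mul_assoc, Real.mul_self_sqrt (Nat.cast_nonneg L)]
    · simp
  refine (mul_le_mul_of_nonneg_left h3 hs.le).trans (le_of_eq ?_)
  linear_combination (3 * D + ε * (B + 2 * D)) * mul_step hL

end Interpolation

/-! ### Densities on the plane and their projections -/

section ImageDensity

variable {K : ℝ≥0} {f : Plane → ℝ}

theorem IsImageDensity.eq_zero (hf : IsImageDensity K f) {x : Plane} (hx : 1 ≤ ‖x‖) : f x = 0 := by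
  refine image_eq_zero_of_notMem_tsupport fun h => ?_
  have := hf.support_subset h
  rw [mem_ball_zero_iff] at this
  linarith

/-- The compact support keeps a positive distance from the unit circle. The segment from `x` to `y`
therefore meets a point `z` of the disk outside the support, where `f` vanishes, and the Lipschitz
bound in the disk applies to `x` and `z`. -/
theorem IsImageDensity.abs_sub_le_of_norm_lt (hf : IsImageDensity K f) {x y : Plane}
    (hx : ‖x‖ < 1) (hy : 1 ≤ ‖y‖) : |f x - f y| ≤ K * dist x y := by
  rw [hf.eq_zero hy, sub_zero]
  by_cases hxs : x ∈ tsupport f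
  swap
  · rw [image_eq_zero_of_notMem_tsupport hxs, abs_zero]; positivity
  have hcpt : IsCompact (tsupport f) := Metric.isCompact_of_isClosed_isBounded
    (isClosed_tsupport f) (Metric.isBounded_ball.subset hf.support_subset)
  obtain ⟨w, hw, hmax⟩ := hcpt.exists_isMaxOn ⟨x, hxs⟩ continuous_norm.continuousOn
  have hw1 : ‖w‖ < 1 := mem_ball_zero_iff.1 (hf.support_subset hw)
  have hxw : ‖x‖ ≤ ‖w‖ := hmax hxs
  have hcont : ContinuousOn (fun t : ℝ => ‖AffineMap.lineMap x y t‖) (Set.Icc 0 1) :=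
    (AffineMap.lineMap_continuous.norm).continuousOn
  obtain ⟨t, ht, hz⟩ := intermediate_value_Icc zero_le_one hcont
    -- Any radius strictly between the largest norm `‖w‖` on the support and `1` would do.
    (show (‖w‖ + 1) / 2 ∈ _ by
      rw [AffineMap.lineMap_apply_zero, AffineMap.lineMap_apply_one]
      constructor <;> linarith)
  set z : Plane := AffineMap.lineMap x y t
  have hz' : ‖z‖ = (‖w‖ + 1) / 2 := hz
  have hzf : f z = 0 := by
    refine image_eq_zero_of_notMem_tsupport fun h => ?_
    have : ‖z‖ ≤ ‖w‖ := hmax h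
    linarith
  have h1 := hf.lipschitz.dist_le_mul x (mem_ball_zero_iff.2 hx) z
    (mem_ball_zero_iff.2 (by linarith))
  rw [Real.dist_eq, hzf, sub_zero, dist_left_lineMap, Real.norm_of_nonneg ht.1] at h1
  refine h1.trans (mul_le_mul_of_nonneg_left ?_ K.2)
  exact mul_le_of_le_one_left dist_nonneg ht.2

theorem IsImageDensity.abs_sub_le (hf : IsImageDensity K f) (x y : Plane) :
    |f x - f y| ≤ K * dist x y := by
  rcases lt_or_ge ‖x‖ 1 with hx | hx <;> rcases lt_or_ge ‖y‖ 1 with hy | hy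
  · exact hf.lipschitz.dist_le_mul x (mem_ball_zero_iff.2 hx) y (mem_ball_zero_iff.2 hy)
  · exact hf.abs_sub_le_of_norm_lt hx hy
  · rw [abs_sub_comm, dist_comm]; exact hf.abs_sub_le_of_norm_lt hy hx
  · rw [hf.eq_zero hx, hf.eq_zero hy, sub_zero, abs_zero]; positivity

theorem IsImageDensity.continuous (hf : IsImageDensity K f) : Continuous f :=
  (LipschitzWith.of_dist_le_mul (K := K) fun x y => hf.abs_sub_le x y).continuous

/-- A point of the disk is within distance `2` of a unit vector, where `f` vanishes. -/
theorem IsImageDensity.abs_apply_le (hf : IsImageDensity K f) (x : Plane) : |f x| ≤ 2 * K := by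
  have hv : ‖EuclideanSpace.single (0 : Fin 2) (1 : ℝ)‖ = 1 := by simp
  rcases lt_or_ge ‖x‖ 1 with hx | hx
  · have h := hf.abs_sub_le x (EuclideanSpace.single (0 : Fin 2) (1 : ℝ))
    rw [hf.eq_zero hv.ge, sub_zero] at h
    have h2 := dist_le_norm_add_norm x (EuclideanSpace.single (0 : Fin 2) (1 : ℝ))
    nlinarith [K.2]
  · rw [hf.eq_zero hx, abs_zero]; positivity

end ImageDensity

/-! ### Rotations of the plane -/

theorem norm_rotT_sq (θ x y : ℝ) : ‖rotT θ x y‖ ^ 2 = x ^ 2 + y ^ 2 := by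
  rw [EuclideanSpace.norm_sq_eq, Fin.sum_univ_two]
  simp only [rotT, Real.norm_eq_abs, sq_abs]
  simp only [Matrix.cons_val_zero, Matrix.cons_val_one]
  linear_combination (x ^ 2 + y ^ 2) * Real.sin_sq_add_cos_sq θ

theorem abs_le_norm_rotT (θ x y : ℝ) : |x| ≤ ‖rotT θ x y‖ ∧ |y| ≤ ‖rotT θ x y‖ := by
  have h := norm_rotT_sq θ x y
  constructor <;> refine abs_le_of_sq_le_sq ?_ (norm_nonneg _) <;> nlinarith [sq_nonneg x, sq_nonneg y]

theorem rotT_sub (θ x x' y : ℝ) : rotT θ x y - rotT θ x' y = rotT θ (x - x') 0 := by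
  ext i
  fin_cases i <;> simp [rotT] <;> ring

theorem dist_rotT_left (θ x x' y : ℝ) : dist (rotT θ x y) (rotT θ x' y) = |x - x'| := by
  rw [dist_eq_norm, rotT_sub, ← abs_norm, ← sq_eq_sq_iff_abs_eq_abs, norm_rotT_sq]
  ring

theorem norm_le_abs_add_abs (v : Plane) : ‖v‖ ≤ |v 0| + |v 1| := by
  rw [EuclideanSpace.norm_eq, Fin.sum_univ_two]
  refine Real.sqrt_le_iff.2 ⟨by positivity, ?_⟩
  simp only [Real.norm_eq_abs]
  nlinarith [abs_nonneg (v 0), abs_nonneg (v 1)]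

theorem dist_rotT_angle (θ θ' x y : ℝ) :
    dist (rotT θ x y) (rotT θ' x y) ≤ 2 * (|x| + |y|) * |θ - θ'| := by
  have hc := Real.abs_cos_sub_cos_le θ θ'
  have hs := Real.abs_sin_sub_sin_le θ θ'
  rw [dist_eq_norm]
  refine (norm_le_abs_add_abs _).trans ?_
  have e0 : (rotT θ x y - rotT θ' x y) 0 =
      x * (Real.cos θ - Real.cos θ') + y * (Real.sin θ - Real.sin θ') := by
    simp [rotT]; ring
  have e1 : (rotT θ x y - rotT θ' x y) 1 =
      -(x * (Real.sin θ - Real.sin θ')) + y * (Real.cos θ - Real.cos θ') := by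
    simp [rotT]; ring
  rw [e0, e1]
  have h0 := abs_add_le (x * (Real.cos θ - Real.cos θ')) (y * (Real.sin θ - Real.sin θ'))
  have h1 := abs_add_le (-(x * (Real.sin θ - Real.sin θ'))) (y * (Real.cos θ - Real.cos θ'))
  rw [abs_neg] at h1
  simp only [abs_mul] at h0 h1
  have a1 := mul_le_mul_of_nonneg_left hc (abs_nonneg x)
  have a2 := mul_le_mul_of_nonneg_left hc (abs_nonneg y)
  have a3 := mul_le_mul_of_nonneg_left hs (abs_nonneg x)
  have a4 := mul_le_mul_of_nonneg_left hs (abs_nonneg y)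
  linarith

theorem continuous_rotT (θ : ℝ) : Continuous fun q : ℝ × ℝ => rotT θ q.1 q.2 := by
  unfold rotT; fun_prop

theorem measurePreserving_rotT (θ : ℝ) :
    MeasurePreserving (fun q : ℝ × ℝ => rotT θ q.1 q.2) volume volume := by
  set M : Matrix (Fin 2) (Fin 2) ℝ := !![Real.cos θ, Real.sin θ; -Real.sin θ, Real.cos θ] with hM
  have hdet : M.det = 1 := by
    rw [hM, Matrix.det_fin_two_of]
    linear_combination Real.sin_sq_add_cos_sq θ
  have h1 : MeasurePreserving (Matrix.toLin' M) volume volume := by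
    refine ⟨(LinearMap.continuous_of_finiteDimensional _).measurable, ?_⟩
    rw [Real.map_matrix_volume_pi_eq_smul_volume_pi (by rw [hdet]; norm_num), hdet]
    simp
  have h2 := ((PiLp.volume_preserving_toLp (Fin 2)).comp h1).comp
    (volume_preserving_finTwoArrow ℝ).symm
  have e : (fun q : ℝ × ℝ => rotT θ q.1 q.2) =
      (WithLp.toLp 2 ∘ Matrix.toLin' M) ∘ (MeasurableEquiv.finTwoArrow (α := ℝ)).symm := by
    funext q
    refine PiLp.ext fun i => ?_
    fin_cases i <;> simp [rotT, hM]
  rw [e]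
  exact h2

/-! ### Line projections and the Fourier slice identity -/

/-- A bounded measurable function on the plane that vanishes outside of the disk of radius 2. -/
structure IsBoundedSupp (φ : Plane → ℝ) : Prop where
  measurable : Measurable φ
  bounded : ∃ B, ∀ x, |φ x| ≤ B
  eq_zero : ∀ x, 2 ≤ ‖x‖ → φ x = 0

theorem IsImageDensity.isBoundedSupp {K : ℝ≥0} {f : Plane → ℝ} (hf : IsImageDensity K f) :
    IsBoundedSupp f :=
  ⟨hf.continuous.measurable, ⟨_, hf.abs_apply_le⟩, fun _ hx => hf.eq_zero (by linarith)⟩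

section BoundedSupp

variable {φ ψ : Plane → ℝ}

theorem IsBoundedSupp.rotT_eq_zero (hφ : IsBoundedSupp φ) (θ x : ℝ) {y : ℝ} (hy : 2 ≤ |y|) :
    φ (rotT θ x y) = 0 :=
  hφ.eq_zero _ (hy.trans (abs_le_norm_rotT θ x y).2)

theorem IsBoundedSupp.integrable (hφ : IsBoundedSupp φ) : Integrable φ := by
  obtain ⟨B, hB⟩ := hφ.bounded
  have hsub : Function.support φ ⊆ Metric.ball 0 2 := by
    intro x hx
    by_contra h
    rw [mem_ball_zero_iff, not_lt] at h
    exact hx (hφ.eq_zero x h)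
  rw [← integrableOn_iff_integrable_of_support_subset hsub]
  exact Measure.integrableOn_of_bounded measure_ball_lt_top.ne
    hφ.measurable.aestronglyMeasurable (Filter.Eventually.of_forall hB)

theorem IsBoundedSupp.slice_support (hφ : IsBoundedSupp φ) (θ x : ℝ) :
    Function.support (fun y => φ (rotT θ x y)) ⊆ Set.Ioc (-2) 2 := by
  intro y hy
  by_contra h
  refine hy (hφ.rotT_eq_zero θ x ?_)
  by_contra! h2
  rw [abs_lt] at h2
  exact h ⟨h2.1, h2.2.le⟩

theorem IsBoundedSupp.integrable_slice (hφ : IsBoundedSupp φ) (θ x : ℝ) :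
    Integrable fun y => φ (rotT θ x y) := by
  obtain ⟨B, hB⟩ := hφ.bounded
  rw [← integrableOn_iff_integrable_of_support_subset (hφ.slice_support θ x)]
  refine Measure.integrableOn_of_bounded measure_Ioc_lt_top.ne
    (hφ.measurable.comp ?_).aestronglyMeasurable (Filter.Eventually.of_forall fun y => hB _)
  exact ((continuous_rotT θ).comp (by fun_prop : Continuous fun y : ℝ => (x, y))).measurable

/-- Every slice is supported in `|y| ≤ 2`, an interval of length `4`. -/
theorem IsBoundedSupp.abs_radon_sub_le (hφ : IsBoundedSupp φ) (hψ : IsBoundedSupp ψ)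
    {θ θ' x x' D : ℝ} (h : ∀ y, |y| ≤ 2 → |φ (rotT θ x y) - ψ (rotT θ' x' y)| ≤ D) :
    |radon φ θ x - radon ψ θ' x'| ≤ 4 * D := by
  unfold radon
  rw [← integral_sub (hφ.integrable_slice θ x) (hψ.integrable_slice θ' x')]
  have h1 : ∫ y, (φ (rotT θ x y) - ψ (rotT θ' x' y)) =
      ∫ y in (-2 : ℝ)..2, (φ (rotT θ x y) - ψ (rotT θ' x' y)) := by
    rw [intervalIntegral.integral_of_le (by norm_num)]
    refine (setIntegral_eq_integral_of_forall_compl_eq_zero fun y hy => ?_).symm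
    have a1 : φ (rotT θ x y) = 0 := by
      by_contra hne; exact hy (hφ.slice_support θ x hne)
    have a2 : ψ (rotT θ' x' y) = 0 := by
      by_contra hne; exact hy (hψ.slice_support θ' x' hne)
    rw [a1, a2, sub_zero]
  rw [h1, ← Real.norm_eq_abs]
  refine (intervalIntegral.norm_integral_le_of_norm_le_const (C := D) fun y hy => ?_).trans ?_
  · rw [Set.uIoc_of_le (by norm_num)] at hy
    exact h y (abs_le.2 ⟨hy.1.le, hy.2⟩)
  · norm_num; linarith

theorem IsBoundedSupp.radon_eq_zero (hφ : IsBoundedSupp φ) (θ : ℝ) {x : ℝ} (hx : 2 ≤ |x|) :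
    radon φ θ x = 0 := by
  unfold radon
  simp [fun y => hφ.eq_zero (rotT θ x y) (hx.trans (abs_le_norm_rotT θ x y).1)]

theorem integral_plane_eq {Φ : Plane → ℂ} (hΦ : Integrable Φ) (θ : ℝ) :
    ∫ v, Φ v = ∫ x, ∫ y, Φ (rotT θ x y) := by
  have hmp := measurePreserving_rotT θ
  have hΦ' : Integrable (fun q : ℝ × ℝ => Φ (rotT θ q.1 q.2)) volume :=
    hmp.integrable_comp_of_integrable hΦ
  rw [← hmp.map_eq, integral_map hmp.measurable.aemeasurable
    (by rw [hmp.map_eq]; exact hΦ.aestronglyMeasurable)]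
  exact integral_prod _ hΦ'

theorem IsBoundedSupp.integrable_radon (hφ : IsBoundedSupp φ) (θ : ℝ) :
    Integrable (radon φ θ) := by
  have h : Integrable (fun q : ℝ × ℝ => φ (rotT θ q.1 q.2)) volume :=
    (measurePreserving_rotT θ).integrable_comp_of_integrable hφ.integrable
  exact Integrable.integral_prod_left h

/-- The Fourier slice identity: in rotated coordinates the phase depends on `x` only, so the
integration over `y` yields the projection. The factor `1 / 2` in the frequency turns `2 π` into
`π`. -/
theorem IsBoundedSupp.integral_mul_character (hφ : IsBoundedSupp φ) (θ : ℝ) (q : ℤ) :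
    ∫ v, Complex.exp (((-2 * Real.pi * inner ℝ v (((q : ℝ) / 2) • rotT θ 1 0) : ℝ) : ℂ) *
      Complex.I) • ((φ v : ℝ) : ℂ) = ∫ x, ((radon φ θ x : ℝ) : ℂ) * character (-q) x := by
  have hin : ∀ x y, inner ℝ (rotT θ x y) (((q : ℝ) / 2) • rotT θ 1 0) = q / 2 * x := by
    intro x y
    rw [real_inner_smul_right, PiLp.inner_apply, Fin.sum_univ_two]
    simp only [rotT, Real.inner_apply, Matrix.cons_val_zero,
      Matrix.cons_val_one, Matrix.cons_val_fin_one, one_mul, zero_mul, add_zero, neg_mul]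
    linear_combination (q / 2 * x) * Real.sin_sq_add_cos_sq θ
  rw [integral_plane_eq _ θ]
  · congr 1
    ext x
    unfold radon
    rw [← integral_complex_ofReal, ← integral_mul_const]
    congr 1
    ext y
    rw [hin, character_eq, smul_eq_mul, mul_comm]
    congr 2
    push_cast
    ring
  · refine Integrable.bdd_mul (c := 1) hφ.integrable.ofReal ?_ ?_
    · exact Continuous.aestronglyMeasurable (by fun_prop)
    · refine Filter.Eventually.of_forall fun v => ?_
      rw [Complex.norm_exp_ofReal_mul_I]

theorem IsBoundedSupp.integral_radon (hφ : IsBoundedSupp φ) (θ : ℝ) :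
    ∫ x, radon φ θ x = ∫ v, φ v := by
  have h := hφ.integral_mul_character θ 0
  simp only [Int.cast_zero, zero_div, zero_smul, inner_zero_right, mul_zero, Complex.ofReal_zero,
    zero_mul, Complex.exp_zero, one_smul, neg_zero, character_zero_left, mul_one,
    integral_complex_ofReal] at h
  exact_mod_cast h.symm

end BoundedSupp

/-- The projections of an image density are Lipschitz probability densities. -/
theorem IsImageDensity.isLipDensity {K : ℝ≥0} {f : Plane → ℝ} (hf : IsImageDensity K f) (θ : ℝ) :
    IsLipDensity (4 * K) (radon f θ) := by
  have hb := hf.isBoundedSupp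
  have hz : ∀ x, 1 ≤ |x| → radon f θ x = 0 := by
    intro x hx
    unfold radon
    simp [fun y => hf.eq_zero (x := rotT θ x y) (hx.trans (abs_le_norm_rotT θ x y).1)]
  refine ⟨fun x => ?_, fun x y => ?_, hz, ?_⟩
  · exact integral_nonneg fun y => hf.nonneg (rotT θ x y)
  · rw [mul_assoc]
    refine hb.abs_radon_sub_le hb fun t _ => ?_
    rw [← dist_rotT_left θ x y t]
    exact hf.abs_sub_le _ _
  · refine Eq.trans ?_ ((hb.integral_radon θ).trans hf.integral_eq_one)
    rw [intervalIntegral.integral_of_le (by norm_num)]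
    refine setIntegral_eq_integral_of_forall_compl_eq_zero fun x hx => hz x ?_
    by_contra! h
    rw [abs_lt] at h
    exact hx ⟨h.1, h.2.le⟩

theorem IsImageDensity.abs_radon_angle_sub_le {K : ℝ≥0} {f : Plane → ℝ} (hf : IsImageDensity K f)
    (θ θ' : ℝ) {x : ℝ} (hx : |x| ≤ 1) :
    |radon f θ x - radon f θ' x| ≤ 24 * K * |θ - θ'| := by
  have hb := hf.isBoundedSupp
  -- The rotation moves the point by at most `2 * (|x| + |y|) * |θ - θ'|`, and `|x| ≤ 1`, `|y| ≤ 2`.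
  have h := hb.abs_radon_sub_le hb (θ := θ) (θ' := θ') (x := x) (x' := x)
    (D := K * (6 * |θ - θ'|)) fun y hy => by
      refine (hf.abs_sub_le _ _).trans (mul_le_mul_of_nonneg_left ?_ K.2)
      refine (dist_rotT_angle θ θ' x y).trans (mul_le_mul_of_nonneg_right ?_ (abs_nonneg _))
      linarith
  linarith

/-! ### Pixel images -/

section Pixel

variable {K : ℝ≥0} {f : Plane → ℝ} {L : ℕ}

theorem measurableSet_cell (L a b : ℕ) : MeasurableSet (cell L a b) := by
  have h0 : Measurable fun x : Plane => x 0 := by fun_prop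
  have h1 : Measurable fun x : Plane => x 1 := by fun_prop
  exact (h0 measurableSet_Ico).inter (h1 measurableSet_Ico)

theorem exists_node_interval (hL : 0 < L) {s : ℝ} (hs : s ∈ Set.Ico (-1 : ℝ) 1) :
    ∃ m : Fin L, s ∈ Set.Ico (node L m) (node L (m + 1)) := by
  have h := floor_node_le hL hs.1
  refine ⟨⟨⌊(s + 1) / step L⌋₊, ?_⟩, h.1, h.2⟩
  rw [Nat.floor_lt (div_nonneg (by linarith [hs.1]) (step_pos hL).le), div_lt_iff₀ (step_pos hL),
    mul_step hL]
  linarith [hs.2]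

theorem node_interval_unique (hL : 0 < L) {s : ℝ} {m k : ℕ}
    (hm : s ∈ Set.Ico (node L m) (node L (m + 1)))
    (hk : s ∈ Set.Ico (node L k) (node L (k + 1))) : m = k := by
  have h1 : ∀ {m k : ℕ}, s ∈ Set.Ico (node L m) (node L (m + 1)) →
      s ∈ Set.Ico (node L k) (node L (k + 1)) → m ≤ k := by
    intro m k hm hk
    by_contra! h
    have := node_mono hL (Nat.succ_le_of_lt h)
    simp only [Nat.succ_eq_add_one] at this
    linarith [hm.1, hk.2]
  exact le_antisymm (h1 hm hk) (h1 hk hm)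

theorem sum_indicator_cell_of_mem (hL : 0 < L) {x : Plane} {a b : Fin L} (hx : x ∈ cell L a b)
    (φ : Fin L → Fin L → Plane → ℝ) :
    ∑ a' : Fin L, ∑ b' : Fin L, (cell L a' b').indicator (φ a' b') x = φ a b x := by
  rw [Finset.sum_eq_single a, Finset.sum_eq_single b, Set.indicator_of_mem hx]
  · intro b' _ hb'
    refine Set.indicator_of_notMem (fun h => hb' ?_) _
    exact Fin.ext (node_interval_unique hL h.2 hx.2)
  · simp
  · intro a' _ ha'
    refine Finset.sum_eq_zero fun b' _ => Set.indicator_of_notMem (fun h => ha' ?_) _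
    exact Fin.ext (node_interval_unique hL h.1 hx.1)
  · simp

theorem cell_subset (hL : 0 < L) (a b : Fin L) {x : Plane} (hx : x ∈ cell L a b) :
    x 0 ∈ Set.Ico (-1 : ℝ) 1 ∧ x 1 ∈ Set.Ico (-1 : ℝ) 1 := by
  have h1 := node_mem_Icc hL a.2.le
  have h2 := node_mem_Icc hL a.2
  have h3 := node_mem_Icc hL b.2.le
  have h4 := node_mem_Icc hL b.2
  exact ⟨⟨h1.1.trans hx.1.1, hx.1.2.trans_le h2.2⟩, ⟨h3.1.trans hx.2.1, hx.2.2.trans_le h4.2⟩⟩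

theorem sum_indicator_cell_of_notMem (hL : 0 < L) {x : Plane}
    (hx : ¬ (x 0 ∈ Set.Ico (-1 : ℝ) 1 ∧ x 1 ∈ Set.Ico (-1 : ℝ) 1))
    (φ : Fin L → Fin L → Plane → ℝ) :
    ∑ a' : Fin L, ∑ b' : Fin L, (cell L a' b').indicator (φ a' b') x = 0 :=
  Finset.sum_eq_zero fun a _ => Finset.sum_eq_zero fun b _ =>
    Set.indicator_of_notMem (fun h => hx (cell_subset hL a b h)) _

theorem one_le_norm_of_notMem_square {x : Plane}
    (hx : ¬ (x 0 ∈ Set.Ico (-1 : ℝ) 1 ∧ x 1 ∈ Set.Ico (-1 : ℝ) 1)) : 1 ≤ ‖x‖ := by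
  by_contra! h
  have h0 := (PiLp.norm_apply_le x 0).trans_lt h
  have h1 := (PiLp.norm_apply_le x 1).trans_lt h
  rw [Real.norm_eq_abs, abs_lt] at h0 h1
  exact hx ⟨⟨h0.1.le, h0.2⟩, ⟨h1.1.le, h1.2⟩⟩

theorem norm_lt_two_of_mem_square {x : Plane}
    (hx : x 0 ∈ Set.Ico (-1 : ℝ) 1 ∧ x 1 ∈ Set.Ico (-1 : ℝ) 1) : ‖x‖ < 2 := by
  have h : ‖x‖ ^ 2 = x 0 ^ 2 + x 1 ^ 2 := by
    rw [EuclideanSpace.norm_sq_eq, Fin.sum_univ_two]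
    simp
  obtain ⟨⟨h1, h2⟩, ⟨h3, h4⟩⟩ := hx
  have h5 : x 0 ^ 2 ≤ 1 := by nlinarith
  have h6 : x 1 ^ 2 ≤ 1 := by nlinarith
  by_contra! h7
  nlinarith

theorem IsImageDensity.sum_integral_cell (hf : IsImageDensity K f) (hL : 0 < L) :
    ∑ a : Fin L, ∑ b : Fin L, ∫ x in cell L a b, f x = 1 := by
  have hi := hf.isBoundedSupp.integrable
  rw [← hf.integral_eq_one]
  have e : f = fun x => ∑ a : Fin L, ∑ b : Fin L, (cell L a b).indicator f x := by
    ext x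
    by_cases hx : x 0 ∈ Set.Ico (-1 : ℝ) 1 ∧ x 1 ∈ Set.Ico (-1 : ℝ) 1
    · obtain ⟨a, ha⟩ := exists_node_interval hL hx.1
      obtain ⟨b, hb⟩ := exists_node_interval hL hx.2
      exact (sum_indicator_cell_of_mem hL (a := a) (b := b) ⟨ha, hb⟩ fun _ _ => f).symm
    · rw [sum_indicator_cell_of_notMem hL hx fun _ _ => f,
        hf.eq_zero (one_le_norm_of_notMem_square hx)]
  refine Eq.trans ?_ (congrArg (fun φ : Plane → ℝ => ∫ x, φ x) e.symm)
  have hib : ∀ a b : Fin L, Integrable ((cell L a b).indicator f) := fun a b =>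
    hi.indicator (measurableSet_cell L a b)
  have h1 : ∀ a : Fin L, ∫ x, ∑ b : Fin L, (cell L a b).indicator f x =
      ∑ b : Fin L, ∫ x in cell L a b, f x := by
    intro a
    rw [integral_finsetSum Finset.univ fun b _ => hib a b]
    exact Finset.sum_congr rfl fun b _ => integral_indicator (measurableSet_cell L a b)
  have h2 := integral_finsetSum (μ := volume) Finset.univ
    (f := fun (a : Fin L) x => ∑ b : Fin L, (cell L a b).indicator f x)
    fun a _ => integrable_finsetSum Finset.univ fun b _ => hib a b
  simp only [h1] at h2
  exact h2.symm

/-- The cells cover the support, so the cell masses already add up to `1` and the normalization only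
cancels the cell area. -/
theorem IsImageDensity.pixelImage_eq (hf : IsImageDensity K f) (hL : 0 < L) (a b : Fin L) :
    pixelImage L f a b = ∫ x in cell L a b, f x := by
  have hs := step_pos hL
  unfold pixelImage
  rw [Matrix.of_apply]
  unfold cellAverage
  simp only [← Finset.mul_sum]
  rw [hf.sum_integral_cell hL, mul_one, mul_div_cancel_left₀]
  positivity

theorem volume_cell (hL : 0 < L) (a b : ℕ) :
    volume (cell L a b) = ENNReal.ofReal (step L ^ 2) := by
  have h : cell L a b = (@WithLp.ofLp 2 (Fin 2 → ℝ)) ⁻¹' (Set.univ.pi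
      ![Set.Ico (node L a) (node L (a + 1)), Set.Ico (node L b) (node L (b + 1))]) := by
    ext x
    simp [cell, Set.mem_pi, Fin.forall_fin_two]
  rw [h, (PiLp.volume_preserving_ofLp (Fin 2)).measure_preimage]
  · rw [volume_pi_pi, Fin.prod_univ_two]
    simp only [Matrix.cons_val_zero, Matrix.cons_val_one, Matrix.cons_val_fin_one,
      Real.volume_Ico, node_succ, add_sub_cancel_left]
    rw [← ENNReal.ofReal_mul (step_pos hL).le, sq]
  · refine (MeasurableSet.univ_pi fun i => ?_).nullMeasurableSet
    fin_cases i <;> exact measurableSet_Ico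

theorem dist_le_of_mem_cell {a b : ℕ} {x y : Plane} (hx : x ∈ cell L a b)
    (hy : y ∈ cell L a b) : dist x y ≤ 2 * step L := by
  rw [dist_eq_norm]
  refine (norm_le_abs_add_abs _).trans ?_
  obtain ⟨⟨h1, h2⟩, ⟨h3, h4⟩⟩ := hx
  obtain ⟨⟨h5, h6⟩, ⟨h7, h8⟩⟩ := hy
  rw [node_succ] at h2 h4 h6 h8
  have e0 : |(x - y) 0| ≤ step L := by
    rw [PiLp.sub_apply, abs_le]; constructor <;> linarith
  have e1 : |(x - y) 1| ≤ step L := by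
    rw [PiLp.sub_apply, abs_le]; constructor <;> linarith
  linarith

theorem IsImageDensity.abs_pixelDensity_sub_le (hf : IsImageDensity K f) (hL : 0 < L) (x : Plane) :
    |pixelDensity L (pixelImage L f) x - f x| ≤ 2 * K * step L := by
  have hs := step_pos hL
  have hi := hf.isBoundedSupp.integrable
  unfold pixelDensity
  by_cases hx : x 0 ∈ Set.Ico (-1 : ℝ) 1 ∧ x 1 ∈ Set.Ico (-1 : ℝ) 1
  · obtain ⟨a, ha⟩ := exists_node_interval hL hx.1
    obtain ⟨b, hb⟩ := exists_node_interval hL hx.2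
    have hxc : x ∈ cell L a b := ⟨ha, hb⟩
    rw [sum_indicator_cell_of_mem hL hxc fun a b _ => pixelImage L f a b / step L ^ 2,
      hf.pixelImage_eq hL]
    have hvol : volume.real (cell L a b) = step L ^ 2 := by
      rw [measureReal_def, volume_cell hL, ENNReal.toReal_ofReal (by positivity)]
    have hfin : volume (cell L a b) < ∞ := by rw [volume_cell hL]; exact ENNReal.ofReal_lt_top
    have h1 : ∫ y in cell L a b, (f y - f x) = (∫ y in cell L a b, f y) - step L ^ 2 * f x := by
      rw [integral_sub hi.integrableOn (integrableOn_const hfin.ne), setIntegral_const, hvol,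
        smul_eq_mul]
    have h2 := norm_setIntegral_le_of_norm_le_const (f := fun y => f y - f x)
      (C := 2 * K * step L) hfin fun y hy => by
        refine (hf.abs_sub_le y x).trans ?_
        calc (K : ℝ) * dist y x ≤ K * (2 * step L) := by
              gcongr; exact dist_le_of_mem_cell hy hxc
          _ = _ := by ring
    rw [h1, hvol, Real.norm_eq_abs] at h2
    have h3 : (∫ y in cell L a b, f y) / step L ^ 2 - f x =
        ((∫ y in cell L a b, f y) - step L ^ 2 * f x) / step L ^ 2 := by field_simp
    rw [h3, abs_div, abs_of_pos (by positivity : 0 < step L ^ 2), div_le_iff₀ (by positivity)]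
    exact h2
  · rw [sum_indicator_cell_of_notMem hL hx fun a b _ => pixelImage L f a b / step L ^ 2,
      hf.eq_zero (one_le_norm_of_notMem_square hx), sub_zero, abs_zero]
    positivity

/-- Cells that meet the unit circle may carry mass outside the disk, up to the corners of the square
at norm `√2`. Hence the support radius `2` in place of `1`. -/
theorem IsImageDensity.isBoundedSupp_pixelDensity (hf : IsImageDensity K f) (hL : 0 < L) :
    IsBoundedSupp (pixelDensity L (pixelImage L f)) := by
  refine ⟨?_, ⟨2 * K * step L + 2 * K, fun x => ?_⟩, fun x hx => ?_⟩
  · unfold pixelDensity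
    exact Finset.measurable_fun_sum _ fun a _ => Finset.measurable_fun_sum _ fun b _ =>
      measurable_const.indicator (measurableSet_cell L a b)
  · have h1 := hf.abs_pixelDensity_sub_le hL x
    have h2 := hf.abs_apply_le x
    have h3 := abs_add_le (pixelDensity L (pixelImage L f) x - f x) (f x)
    rw [sub_add_cancel] at h3
    linarith
  · refine sum_indicator_cell_of_notMem hL (fun h => ?_) fun a b _ => _
    linarith [norm_lt_two_of_mem_square h]

theorem IsImageDensity.abs_radon_pixelDensity_sub_le (hf : IsImageDensity K f) (hL : 0 < L)
    (θ x : ℝ) :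
    |radon (pixelDensity L (pixelImage L f)) θ x - radon f θ x| ≤ 8 * K * step L := by
  have h := (hf.isBoundedSupp_pixelDensity hL).abs_radon_sub_le hf.isBoundedSupp
    (θ := θ) (θ' := θ) (x := x) (x' := x) fun y _ => hf.abs_pixelDensity_sub_le hL _
  linarith

end Pixel

/-! ### Fourier samples of the projections -/

/-- The sum of the three translates by multiples of 2 of a function supported in `[-3, 3]` that are
visible on `[-1, 1]`. -/
def periodize (p : ℝ → ℝ) (s : ℝ) : ℝ := p (s - 2) + p s + p (s + 2)

/-- The characters have period `2`, so the outer parts of the line fold onto `[-1, 1]`. Projections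
of pixel densities can reach beyond `[-1, 1]`, so the folding matters. -/
theorem integral_mul_character_eq_periodize {p : ℝ → ℝ} (hp : Integrable p)
    (h0 : ∀ x, 2 ≤ |x| → p x = 0) (q : ℤ) :
    ∫ x, ((p x : ℝ) : ℂ) * character q x =
      ∫ s in (-1 : ℝ)..1, ((periodize p s : ℝ) : ℂ) * character q s := by
  set g : ℝ → ℂ := fun x => ((p x : ℝ) : ℂ) * character q x with hg
  have hgi : Integrable g := by
    refine Integrable.mul_bdd (c := 1) hp.ofReal (continuous_character q).aestronglyMeasurable ?_
    exact Filter.Eventually.of_forall fun x => (norm_character q x).le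
  have hgii : ∀ a b, IntervalIntegrable g volume a b := fun a b => hgi.intervalIntegrable
  have h1 : ∫ x, g x = ∫ x in (-3 : ℝ)..3, g x := by
    rw [intervalIntegral.integral_of_le (by norm_num)]
    refine (setIntegral_eq_integral_of_forall_compl_eq_zero fun x hx => ?_).symm
    have : p x = 0 := by
      refine h0 x ?_
      by_contra! h
      rw [abs_lt] at h
      exact hx ⟨by linarith [h.1], by linarith [h.2]⟩
    simp [hg, this]
  have h2 : ∫ x in (-3 : ℝ)..(-1), g x = ∫ s in (-1 : ℝ)..1, g (s - 2) := by
    rw [intervalIntegral.integral_comp_sub_right]; norm_num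
  have h3 : ∫ x in (1 : ℝ)..3, g x = ∫ s in (-1 : ℝ)..1, g (s + 2) := by
    rw [intervalIntegral.integral_comp_add_right]; norm_num
  have i2 : IntervalIntegrable (fun s => g (s - 2)) volume (-1) 1 :=
    (hgi.comp_sub_right 2).intervalIntegrable
  have i3 : IntervalIntegrable (fun s => g (s + 2)) volume (-1) 1 :=
    (hgi.comp_add_right 2).intervalIntegrable
  rw [h1, ← intervalIntegral.integral_add_adjacent_intervals (hgii (-3) (-1)) (hgii (-1) 3),
    ← intervalIntegral.integral_add_adjacent_intervals (hgii (-1) 1) (hgii 1 3), h2, h3,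
    ← add_assoc, ← intervalIntegral.integral_add i2 (hgii _ _),
    ← intervalIntegral.integral_add (i2.add (hgii _ _)) i3]
  congr 1
  ext s
  have e1 : character q (s + 2) = character q s := by
    rw [character_add, character_two, mul_one]
  have e2 : character q (s - 2) = character q s := by
    have := character_add q (s - 2) 2
    rw [sub_add_cancel, character_two, mul_one] at this
    exact this.symm
  simp only [hg, periodize, e1, e2]
  push_cast
  ring

/-! ### The error for image densities, at one angle and on average -/

section Assembly

variable {K : ℝ≥0} {f g : Plane → ℝ} {L : ℕ}

theorem IsImageDensity.exactSlice_eq (hf : IsImageDensity K f) (hL : 0 < L) (θ : ℝ) (j : Fin L) :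
    exactSlice L (pixelImage L f) θ j = ∫ s in (-1 : ℝ)..1,
      ((periodize (radon (pixelDensity L (pixelImage L f)) θ) s : ℝ) : ℂ) *
        character (-freq L j) s := by
  have hφ := hf.isBoundedSupp_pixelDensity hL
  unfold exactSlice
  rw [Real.fourier_eq', hφ.integral_mul_character θ (freq L j)]
  exact integral_mul_character_eq_periodize (hφ.integrable_radon θ)
    (fun x hx => hφ.radon_eq_zero θ hx) _

theorem IsLipDensity.periodize_eq {A : ℝ} {p : ℝ → ℝ} (hp : IsLipDensity A p) {s : ℝ}
    (hs : s ∈ Set.Icc (-1 : ℝ) 1) : periodize p s = p s := by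
  unfold periodize
  rw [hp.eq_zero (s - 2), hp.eq_zero (s + 2), zero_add, add_zero]
  · rw [abs_of_nonneg] <;> linarith [hs.1]
  · rw [abs_of_nonpos] <;> linarith [hs.2]

theorem abs_periodize_sub_le {p q : ℝ → ℝ} {D : ℝ} (h : ∀ x, |p x - q x| ≤ D) (s : ℝ) :
    |periodize p s - periodize q s| ≤ 3 * D := by
  unfold periodize
  have h1 := abs_le.1 (h (s - 2))
  have h2 := abs_le.1 (h s)
  have h3 := abs_le.1 (h (s + 2))
  rw [abs_le]; constructor <;> linarith [h1.1, h1.2, h2.1, h2.2, h3.1, h3.2]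

theorem step_le_two (hL : 0 < L) : step L ≤ 2 := by
  unfold step
  rw [div_le_iff₀ (by exact_mod_cast hL)]
  have : (1 : ℝ) ≤ L := by exact_mod_cast hL
  linarith

theorem IsImageDensity.sum_abs_rawProfile_sub_le (hf : IsImageDensity K f) (hL : 0 < L) {θ ε : ℝ}
    (hε : 0 ≤ ε) {Y : Fin L → ℂ}
    (hY : l2norm (Y - exactSlice L (pixelImage L f) θ) ≤
      ε * l2norm (exactSlice L (pixelImage L f) θ)) :
    step L * ∑ m : Fin L, |rawProfile L Y m - radon f θ (node L m)| ≤
      312 * K * step L + 528 * K * ε := by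
  have hs := step_pos hL
  have hs2 := step_le_two hL
  have hp := hf.isLipDensity θ
  have hφ := hf.isBoundedSupp_pixelDensity hL
  have hK : (0 : ℝ) ≤ K := K.2
  set P := periodize (radon (pixelDensity L (pixelImage L f)) θ) with hP
  have hKs : 0 ≤ K * step L := by positivity
  -- Three translates, each with pixelation error `8 * K * step L`. The exact projection equals its
  -- own periodization on `[-1, 1]`.
  have hclose : ∀ s ∈ Set.Icc (-1 : ℝ) 1, |P s - radon f θ s| ≤ 24 * (K * step L) := by
    intro s hs
    have h := abs_periodize_sub_le (fun x => hf.abs_radon_pixelDensity_sub_le hL θ x) s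
    rw [hp.periodize_eq hs] at h
    linarith
  have hper : P 1 = P (-1) := by
    have h3 : radon (pixelDensity L (pixelImage L f)) θ (1 + 2) = 0 :=
      hφ.radon_eq_zero θ (by norm_num)
    have h4 : radon (pixelDensity L (pixelImage L f)) θ (-1 - 2) = 0 :=
      hφ.radon_eq_zero θ (by norm_num)
    rw [hP]
    unfold periodize
    rw [h3, h4]
    norm_num
  have hPi : IntervalIntegrable P volume (-1) 1 := by
    have hi := hφ.integrable_radon θ
    exact ((hi.comp_sub_right 2).add hi |>.add (hi.comp_add_right 2)).intervalIntegrable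
  have hnode : ∀ m : Fin L, node L m ∈ Set.Icc (-1 : ℝ) 1 := fun m => node_mem_Icc hL m.2.le
  -- `P` need not be continuous. It is compared with the exact projection at both points, and `52 =
  -- 24 + 24 + 4`.
  have hlip : ∀ m : Fin L, ∀ δ ∈ Set.Icc 0 (step L),
      |P (node L m + δ) - P (node L m)| ≤ 52 * (K * step L) := by
    intro m δ hδ
    have h1 := abs_le.1 (hclose _ (hnode m))
    have hmem : node L m + δ ∈ Set.Icc (-1 : ℝ) 1 := by
      refine ⟨by linarith [(hnode m).1, hδ.1], ?_⟩
      have := (node_mem_Icc hL m.2).2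
      rw [node_succ] at this
      linarith [hδ.2]
    have h2 := abs_le.1 (hclose _ hmem)
    have h3 := hp.lip (node L m + δ) (node L m)
    rw [add_sub_cancel_left, abs_of_nonneg hδ.1] at h3
    have h4 : 4 * K * δ ≤ 4 * (K * step L) := by
      rw [mul_assoc]; gcongr; exact hδ.2
    have h5 := abs_le.1 (h3.trans h4)
    rw [abs_le]; constructor <;> linarith [h1.1, h1.2, h2.1, h2.2, h5.1, h5.2]
  -- The exact projection vanishes at `1`, hence is at most `8 * K`. The remaining `48 * K` is `24 *
  -- K * step L` with `step L ≤ 2`.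
  have hB : ∀ m : Fin L, |P (node L m)| ≤ 56 * K := by
    intro m
    have h1 := abs_le.1 (hclose _ (hnode m))
    have h2 := hp.lip (node L m) 1
    rw [hp.eq_zero 1 (by norm_num), sub_zero, abs_sub_comm,
      abs_of_nonneg (by linarith [(hnode m).2] : 0 ≤ 1 - node L m)] at h2
    have h3 : 4 * K * (1 - node L m) ≤ 8 * (K : ℝ) := by nlinarith [(hnode m).1]
    have h4 := abs_le.1 (h2.trans h3)
    have h5 : K * step L ≤ (K : ℝ) * 2 := by gcongr
    rw [abs_le]; constructor <;> linarith [h1.1, h1.2, h4.1, h4.2]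
  have h := SlicedWasserstein.sum_abs_rawProfile_sub_le hL (by positivity) hper hPi hlip hB
    (by positivity) hε (fun j => hf.exactSlice_eq hL θ j) hY hp.nonneg fun m =>
      (hclose _ (hnode m)).trans (by linarith)
  refine h.trans ?_
  have h5 : K * step L ≤ (K : ℝ) * 2 := by gcongr
  have h6 := mul_le_mul_of_nonneg_left h5 hε
  linarith

theorem IsImageDensity.radonMeasure_Iic (hf : IsImageDensity K f) (θ t : ℝ) :
    radonMeasure f θ (Set.Iic t) = ENNReal.ofReal (densityCDF (radon f θ) t) := by
  have hp := hf.isLipDensity θ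
  have hi := hf.isBoundedSupp.integrable_radon θ
  unfold radonMeasure densityCDF
  rw [withDensity_apply _ measurableSet_Iic, ← ofReal_integral_eq_lintegral_ofReal
    hi.integrableOn (Filter.Eventually.of_forall hp.nonneg),
    ← intervalIntegral.integral_Iic_sub_Iic hi.integrableOn hi.integrableOn,
    setIntegral_eq_zero_of_forall_eq_zero (t := Set.Iic (-1 : ℝ)), sub_zero]
  intro x hx
  have hx' : x ≤ -1 := hx
  exact hp.eq_zero x (by rw [abs_of_nonpos] <;> linarith)

theorem IsImageDensity.isFiniteMeasure_radonMeasure (hf : IsImageDensity K f) (θ : ℝ) :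
    IsFiniteMeasure (radonMeasure f θ) :=
  isFiniteMeasure_withDensity_ofReal (hf.isBoundedSupp.integrable_radon θ).hasFiniteIntegral

/-- The squared Wasserstein distance of the line projections at the angle `θ`. -/
noncomputable def slicedCost (f g : Plane → ℝ) (θ : ℝ) : ℝ :=
  (crossCost (densityCDF (radon f θ)) (densityCDF (radon g θ))).toReal

theorem wasserstein2_radonMeasure_sq (hf : IsImageDensity K f) (hg : IsImageDensity K g) (θ : ℝ) :
    wasserstein2 (radonMeasure f θ) (radonMeasure g θ) ^ 2 = slicedCost f g θ := by
  have := hf.isFiniteMeasure_radonMeasure θ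
  have := hg.isFiniteMeasure_radonMeasure θ
  exact wasserstein2_sq (hf.isLipDensity θ).isUnitCDF (hg.isLipDensity θ).isUnitCDF
    (hf.radonMeasure_Iic θ) (hg.radonMeasure_Iic θ)

theorem IsImageDensity.abs_densityCDF_sub_le (hf : IsImageDensity K f) (θ θ' : ℝ) {t : ℝ}
    (ht : t ∈ Set.Icc (-1 : ℝ) 1) :
    |densityCDF (radon f θ) t - densityCDF (radon f θ') t| ≤ 48 * K * |θ - θ'| := by
  unfold densityCDF
  rw [← intervalIntegral.integral_sub ((hf.isLipDensity θ).intervalIntegrable _ _)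
    ((hf.isLipDensity θ').intervalIntegrable _ _), ← Real.norm_eq_abs]
  refine (intervalIntegral.norm_integral_le_of_norm_le_const (C := 24 * K * |θ - θ'|)
    fun x hx => ?_).trans ?_
  · rw [Set.uIoc_of_le ht.1] at hx
    exact hf.abs_radon_angle_sub_le θ θ' (abs_le.2 ⟨hx.1.le, hx.2.trans ht.2⟩)
  · rw [abs_of_nonneg (by linarith [ht.1] : 0 ≤ t - -1)]
    have : 0 ≤ 24 * K * |θ - θ'| := by positivity
    nlinarith [ht.2]

/-- Rotation changes each CDF by at most `48 * K * |θ - θ'|`, and the cost is Lipschitz in the pair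
of CDFs with factor `8`. -/
theorem abs_slicedCost_sub_le (hf : IsImageDensity K f) (hg : IsImageDensity K g) (θ θ' : ℝ) :
    |slicedCost f g θ - slicedCost f g θ'| ≤ 768 * K * |θ - θ'| := by
  have h := abs_crossCost_sub_le (hf.isLipDensity θ).isUnitCDF (hg.isLipDensity θ).isUnitCDF
    (hf.isLipDensity θ').isUnitCDF (hg.isLipDensity θ').isUnitCDF
    (fun t ht => hf.abs_densityCDF_sub_le θ θ' ht) (fun t ht => hg.abs_densityCDF_sub_le θ θ' ht)
  unfold slicedCost
  linarith

/-! ### Averages over the angle -/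

theorem continuous_of_abs_sub_le {w : ℝ → ℝ} {Λ : ℝ} (hΛ : 0 ≤ Λ)
    (h : ∀ x y, |w x - w y| ≤ Λ * |x - y|) : Continuous w :=
  (LipschitzWith.of_dist_le_mul (K := ⟨Λ, hΛ⟩) fun x y => h x y).continuous

/-- The error of the left Riemann sum of a Lipschitz function over `[0, T]`. -/
theorem abs_average_sub_riemann_sum_le {w : ℝ → ℝ} {Λ T : ℝ} (hΛ : 0 ≤ Λ) (hT : 0 < T)
    (h : ∀ x y, |w x - w y| ≤ Λ * |x - y|) {n : ℕ} (hn : 0 < n) :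
    |1 / T * (∫ x in (0 : ℝ)..T, w x) - 1 / (n : ℝ) * ∑ k : Fin n, w (T * k / n)| ≤
      Λ * T * (1 / n) := by
  have hn' : (0 : ℝ) < n := by exact_mod_cast hn
  have hw : ∀ a b, IntervalIntegrable w volume a b := fun a b =>
    (continuous_of_abs_sub_le hΛ h).intervalIntegrable a b
  have hsum := intervalIntegral.sum_integral_adjacent_intervals (f := w) (μ := volume)
    (a := fun k : ℕ => T * k / n) (n := n) fun k _ => hw _ _
  simp only [Nat.cast_zero, mul_zero, zero_div, mul_div_cancel_right₀ _ hn'.ne'] at hsum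
  rw [← hsum, Fin.sum_univ_eq_sum_range (fun k : ℕ => w (T * k / n)) n, Finset.mul_sum,
    Finset.mul_sum, ← Finset.sum_sub_distrib]
  have hterm : ∀ k ∈ Finset.range n,
      |1 / T * (∫ x in (T * k / n)..(T * ((k + 1 : ℕ) : ℝ) / n), w x) -
        1 / (n : ℝ) * w (T * k / n)| ≤ Λ * T * (1 / n) * (1 / n) := by
    intro k _
    have hlen : T * ((k + 1 : ℕ) : ℝ) / n - T * k / n = T / n := by push_cast; ring
    have hle : T * k / n ≤ T * ((k + 1 : ℕ) : ℝ) / n := by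
      rw [← sub_nonneg, hlen]; positivity
    have e : 1 / T * (∫ x in (T * k / n)..(T * ((k + 1 : ℕ) : ℝ) / n), w x) -
        1 / (n : ℝ) * w (T * k / n) =
        1 / T * ∫ x in (T * k / n)..(T * ((k + 1 : ℕ) : ℝ) / n), (w x - w (T * k / n)) := by
      rw [intervalIntegral.integral_sub (hw _ _) intervalIntegrable_const,
        intervalIntegral.integral_const, hlen, smul_eq_mul]
      field_simp
    rw [e, abs_mul, abs_of_pos (by positivity : 0 < 1 / T), ← Real.norm_eq_abs (∫ _ in _.._, _)]
    have hb := intervalIntegral.norm_integral_le_of_norm_le_const (C := Λ * (T / n))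
      (f := fun x => w x - w (T * k / n)) (a := T * k / n) (b := T * ((k + 1 : ℕ) : ℝ) / n)
      fun x hx => by
        rw [Set.uIoc_of_le hle] at hx
        refine (h _ _).trans (mul_le_mul_of_nonneg_left ?_ hΛ)
        rw [abs_of_nonneg (by linarith [hx.1]), ← hlen]
        linarith [hx.2]
    rw [hlen, abs_of_pos (by positivity : 0 < T / (n : ℝ))] at hb
    calc _ ≤ 1 / T * (Λ * (T / n) * (T / n)) := by gcongr
      _ = _ := by field_simp
  refine (Finset.abs_sum_le_sum_abs _ _).trans ((Finset.sum_le_sum hterm).trans (le_of_eq ?_))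
  rw [Finset.sum_const, Finset.card_range, nsmul_eq_mul]
  field_simp

theorem slicedWasserstein2_sq (hf : IsImageDensity K f) (hg : IsImageDensity K g) :
    slicedWasserstein2 f g ^ 2 =
      1 / (2 * Real.pi) * ∫ θ in (0 : ℝ)..(2 * Real.pi), slicedCost f g θ := by
  have hpi := Real.pi_pos
  unfold slicedWasserstein2
  simp only [wasserstein2_radonMeasure_sq hf hg]
  refine Real.sq_sqrt (mul_nonneg (by positivity) ?_)
  exact intervalIntegral.integral_nonneg (by positivity) fun θ _ => ENNReal.toReal_nonneg

theorem slicedWasserstein2_sq_mem (hf : IsImageDensity K f) (hg : IsImageDensity K g) :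
    slicedWasserstein2 f g ^ 2 ∈ Set.Icc (0 : ℝ) 4 := by
  have hpi := Real.pi_pos
  refine ⟨sq_nonneg _, ?_⟩
  rw [slicedWasserstein2_sq hf hg, one_div, inv_mul_le_iff₀ (by positivity)]
  have h := intervalIntegral.norm_integral_le_of_norm_le_const (C := 4) (f := slicedCost f g)
    (a := 0) (b := 2 * Real.pi) fun θ _ => by
      rw [Real.norm_of_nonneg (show 0 ≤ slicedCost f g θ from ENNReal.toReal_nonneg)]
      exact crossCost_toReal_le (hf.isLipDensity θ).isUnitCDF (hg.isLipDensity θ).isUnitCDF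
  rw [sub_zero, abs_of_pos (by positivity : 0 < 2 * Real.pi)] at h
  linarith [le_abs_self (∫ θ in (0 : ℝ)..(2 * Real.pi), slicedCost f g θ),
    Real.norm_eq_abs (∫ θ in (0 : ℝ)..(2 * Real.pi), slicedCost f g θ)]

theorem computedSW2_sq {n : ℕ} (Y Z : Fin n → Fin L → ℂ) :
    computedSW2 L n Y Z ^ 2 = 1 / (n : ℝ) * ∑ k : Fin n, 1 / (L : ℝ) * ∑ j : Fin L,
      (discreteICDF L (cumSum L (profile L (Y k))) ((j : ℝ) / L) -
        discreteICDF L (cumSum L (profile L (Z k))) ((j : ℝ) / L)) ^ 2 := by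
  unfold computedSW2
  rw [Real.sq_sqrt (by positivity), ← Finset.mul_sum, ← mul_assoc, Finset.sum_comm,
    one_div_mul_one_div]
  rfl

theorem computedSW2_sq_mem {n : ℕ} (hL : 0 < L) (hn : 0 < n) (Y Z : Fin n → Fin L → ℂ) :
    computedSW2 L n Y Z ^ 2 ∈ Set.Icc (0 : ℝ) 4 := by
  have hn' : (0 : ℝ) < n := by exact_mod_cast hn
  have hL' : (0 : ℝ) < L := by exact_mod_cast hL
  refine ⟨sq_nonneg _, ?_⟩
  rw [computedSW2_sq, one_div, inv_mul_le_iff₀ hn']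
  calc _ ≤ ∑ _k : Fin n, (4 : ℝ) := Finset.sum_le_sum fun k _ => by
        rw [one_div, inv_mul_le_iff₀ hL']
        calc _ ≤ ∑ _j : Fin L, (4 : ℝ) := Finset.sum_le_sum fun j _ => sq_quantile_sub_le _ _ _
          _ = _ := by simp
    _ = _ := by simp

/-- The error of the computed sliced Wasserstein distance. -/
theorem abs_slicedWasserstein2_sub_computedSW2_le (hf : IsImageDensity K f)
    (hg : IsImageDensity K g) {n : ℕ} {ε : ℝ} (hL : 0 < L) (hn : 0 < n) (hε : 0 ≤ ε)
    {Y Z : Fin n → Fin L → ℂ} (hY : IsNUFFT ε L n (pixelImage L f) Y)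
    (hZ : IsNUFFT ε L n (pixelImage L g) Z) :
    |slicedWasserstein2 f g ^ 2 - computedSW2 L n Y Z ^ 2| ≤
      (16 + 50000 * K) * (1 / (n : ℝ) + 1 / (L : ℝ) + ε) := by
  have hn' : (0 : ℝ) < n := by exact_mod_cast hn
  have hL' : (0 : ℝ) < L := by exact_mod_cast hL
  have hK : (0 : ℝ) ≤ K := K.2
  have hpi := Real.pi_pos
  have hangle : |slicedWasserstein2 f g ^ 2 -
      1 / (n : ℝ) * ∑ k : Fin n, slicedCost f g (angle n k)| ≤
      768 * K * (2 * Real.pi) * (1 / n) := by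
    rw [slicedWasserstein2_sq hf hg]
    exact abs_average_sub_riemann_sum_le (by positivity) (by positivity)
      (abs_slicedCost_sub_le hf hg) hn
  set E : ℝ := 16 / L + 32 * (312 * K * step L + 528 * K * ε) + 64 * (4 * K) * step L with hE
  have hslice : ∀ k : Fin n, |slicedCost f g (angle n k) - 1 / (L : ℝ) * ∑ j : Fin L,
      (discreteICDF L (cumSum L (profile L (Y k))) ((j : ℝ) / L) -
        discreteICDF L (cumSum L (profile L (Z k))) ((j : ℝ) / L)) ^ 2| ≤ E := by
    intro k
    have h1 := hY k
    have h2 := hZ k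
    have e : ∀ (v w : Fin L → ℂ), Real.sqrt (∑ j, ‖v j - w j‖ ^ 2) = l2norm (v - w) :=
      fun v w => (l2norm_eq (v - w)).symm
    rw [e, ← l2norm_eq] at h1 h2
    rw [abs_sub_comm]
    exact abs_discrete_cost_sub_le (hf.isLipDensity _) (hg.isLipDensity _) hL
      (hf.sum_abs_rawProfile_sub_le hL hε h1) (hg.sum_abs_rawProfile_sub_le hL hε h2)
  have hsum : |1 / (n : ℝ) * ∑ k : Fin n, slicedCost f g (angle n k) -
      computedSW2 L n Y Z ^ 2| ≤ E := by
    rw [computedSW2_sq, ← mul_sub, ← Finset.sum_sub_distrib, abs_mul,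
      abs_of_pos (by positivity : 0 < 1 / (n : ℝ)), one_div, inv_mul_le_iff₀ hn']
    refine (Finset.abs_sum_le_sum_abs _ _).trans
      ((Finset.sum_le_sum fun k _ => hslice k).trans (le_of_eq ?_))
    simp
  -- With `π ≤ 4` the coefficients are at most `6144 * K` for `1 / n`, `16 + 20480 * K` for `1 / L`
  -- and `16896 * K` for `ε`.
  refine (abs_sub_le _ _ _).trans ((add_le_add hangle hsum).trans ?_)
  have hs : step L = 2 * (1 / L) := by unfold step; ring
  have h16 : (16 : ℝ) / L = 16 * (1 / L) := by ring
  rw [hE, hs, h16]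
  have a1 : 0 ≤ 1 / (n : ℝ) := by positivity
  have a2 : 0 ≤ 1 / (L : ℝ) := by positivity
  have b1 : K * Real.pi * (1 / (n : ℝ)) ≤ K * 4 * (1 / (n : ℝ)) := by
    gcongr; exact Real.pi_le_four
  have b2 : 0 ≤ K * (1 / (n : ℝ)) := by positivity
  have b3 : 0 ≤ K * (1 / (L : ℝ)) := by positivity
  have b4 : 0 ≤ K * ε := by positivity
  linarith

end Assembly

end SlicedWasserstein

/-! ### The linear and the square root bound -/

theorem theorem1 (K : ℝ≥0) :
    (∀ μmin : ℝ, 0 ≤ μmin → ∃ C : ℝ, ∀ f g : SlicedWasserstein.Plane → ℝ,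
      SlicedWasserstein.IsImageDensity K f → SlicedWasserstein.IsImageDensity K g →
      SlicedWasserstein.HasProjectionFloor μmin f →
      SlicedWasserstein.HasProjectionFloor μmin g →
      ∀ (L n : ℕ) (ε : ℝ), 0 < L → 0 < n → 0 ≤ ε →
      ∀ Y Z : Fin n → Fin L → ℂ,
      SlicedWasserstein.IsNUFFT ε L n (SlicedWasserstein.pixelImage L f) Y →
      SlicedWasserstein.IsNUFFT ε L n (SlicedWasserstein.pixelImage L g) Z →
      |SlicedWasserstein.slicedWasserstein2 f g ^ 2 -
          SlicedWasserstein.computedSW2 L n Y Z ^ 2| ≤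
        C * (1 / (n : ℝ) + 1 / (L : ℝ) + ε)) ∧
    (∃ C' : ℝ, ∀ f g : SlicedWasserstein.Plane → ℝ,
      SlicedWasserstein.IsImageDensity K f → SlicedWasserstein.IsImageDensity K g →
      ∀ (L n : ℕ) (ε : ℝ), 0 < L → 0 < n → 0 ≤ ε →
      ∀ Y Z : Fin n → Fin L → ℂ,
      SlicedWasserstein.IsNUFFT ε L n (SlicedWasserstein.pixelImage L f) Y →
      SlicedWasserstein.IsNUFFT ε L n (SlicedWasserstein.pixelImage L g) Z →
      |SlicedWasserstein.slicedWasserstein2 f g ^ 2 -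
          SlicedWasserstein.computedSW2 L n Y Z ^ 2| ≤
        C' * (1 / (n : ℝ) + 1 / Real.sqrt (L : ℝ) + Real.sqrt ε)) := by
  refine ⟨fun _ _ => ⟨16 + 50000 * K, fun f g hf hg _ _ L n ε hL hn hε Y Z hY hZ =>
    SlicedWasserstein.abs_slicedWasserstein2_sub_computedSW2_le hf hg hL hn hε hY hZ⟩,
    ⟨16 + 50000 * K, fun f g hf hg L n ε hL hn hε Y Z hY hZ => ?_⟩⟩
  have hK : (0 : ℝ) ≤ K := K.2
  have hL1 : (1 : ℝ) ≤ L := by exact_mod_cast hL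
  rcases le_total ε 1 with h1 | h1
  · refine (SlicedWasserstein.abs_slicedWasserstein2_sub_computedSW2_le hf hg hL hn hε hY
      hZ).trans (mul_le_mul_of_nonneg_left ?_ (by positivity))
    have h2 : ε ≤ Real.sqrt ε := Real.le_sqrt_of_sq_le (by nlinarith)
    have h3 : 1 / (L : ℝ) ≤ 1 / Real.sqrt L :=
      one_div_le_one_div_of_le (Real.sqrt_pos.2 (by linarith))
        (Real.sqrt_le_iff.2 ⟨by linarith, by nlinarith⟩)
    linarith
  -- For `ε ≥ 1` the linear bound does not give the square root rate. But both squared distances lie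
  -- in `[0, 4]`, and the right side is at least `16`.
  · obtain ⟨a1, a2⟩ := SlicedWasserstein.slicedWasserstein2_sq_mem hf hg
    obtain ⟨b1, b2⟩ := SlicedWasserstein.computedSW2_sq_mem hL hn Y Z
    have h2 : 1 ≤ Real.sqrt ε := Real.one_le_sqrt.2 h1
    have h3 : (1 : ℝ) ≤ 1 / (n : ℝ) + 1 / Real.sqrt (L : ℝ) + Real.sqrt ε := by
      have : 0 ≤ 1 / (n : ℝ) := by positivity
      have : 0 ≤ 1 / Real.sqrt (L : ℝ) := by positivity
      linarith
    have h4 : (16 : ℝ) ≤ (16 + 50000 * K) * (1 / (n : ℝ) + 1 / Real.sqrt (L : ℝ) +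
        Real.sqrt ε) := by nlinarith
    rw [abs_le]; constructor <;> linarith
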